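/- **Conventions.** Let $M$ be a smooth manifold of dimension $m$. A codimension-$d$ *almost CR structure* on $M$ is a pair $(HM,J)$ consisting of a smooth subbundle $HM\subseteq TM$ of rank $m-d$ and a smooth bundle map $J:HM\to HM$ with $J^2=-\mathrm{id}$. It is a *CR structure* if, for all smooth local sections $X,Y$ of $HM$, $$[JX,Y]+[X,JY]\in\Gamma(HM),\qquad [JX,JY]-J\big([JX,Y]+[X,JY]\big)-[X,Y]=0 .$$ A smooth map $f:(M,HM,J)\to(N,HN,J^N)$ is a *CR map* if $df(HM)\subseteq HN$ and $df\circ J=J^N\circ df$ on $HM$. In local coordinates $(x^i)$ of $M$ and the induced coordinates $(x^i,y^i)$ of $TM$, the vertical and complete lifts to $TM$ of a vector field $Z=z^i\frac{\partial}{\partial x^i}$ and the complete lift of a $(1,1)$-tensor field $A=A_i^j\frac{\partial}{\partial x^j}\otimes dx^i$ are $$Z^V=z^i\frac{\partial}{\partial y^i},\qquad Z^C=z^i\frac{\partial}{\partial x^i}+y^j\frac{\partial z^i}{\partial x^j}\frac{\partial}{\partial y^i},$$ $$A^C=A_i^j\frac{\partial}{\partial x^j}\otimes dx^i+y^k\frac{\partial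 A_i^j}{\partial x^k}\frac{\partial}{\partial y^j}\otimes dx^i+A_i^j\frac{\partial}{\partial y^j}\otimes dy^i .$$ **Theorem.** Let $(HM,J)$ be a codimension-$d$ CR structure on $M$. Then there is a codimension-$2d$ CR structure $(H,J')$ on the manifold $TM$ such that the projection $TM\to M$ is a CR map. Moreover, it can be chosen such that 1. at each point, $H$ is spanned by the values of the lifts $Z^V$ and $Z^C$ of the smooth local sections $Z$ of $HM$; 2. $J'$ is the complete lift $J^C$ of $J$: whenever $A$ is a smooth $(1,1)$-tensor field on an open set $U\subseteq M$ with $A|_{HM}=J$, one has $J'=A^C|_{H}$ over $U$; in particular $J'Z^V=(JZ)^V$ and $J'Z^C=(JZ)^C$ for all smooth local sections $Z$ of $HM$. -/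

import Mathlib

open scoped Manifold ContDiff

noncomputable section

section CRStructures

variable {E : Type*} [NormedAddCommGroup E] [NormedSpace ℝ E]
  {H : Type*} [TopologicalSpace H] (I : ModelWithCorners ℝ E H)
  {M : Type*} [TopologicalSpace M] [ChartedSpace H M] [IsManifold I ∞ M]

/-- The vector field `X` (given at every point of `M`) is smooth on the set `U`. -/
def SmoothFieldOn (X : ∀ x : M, TangentSpace I x) (U : Set M) : Prop :=
  ContMDiffOn I I.tangent ∞ (fun x => (⟨x, X x⟩ : TangentBundle I M)) U

/-- The field `A` of endomorphisms of the tangent spaces is a smooth `(1,1)`-tensor field on the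
set `U`. -/
def SmoothTensorOn (A : ∀ x : M, TangentSpace I x →L[ℝ] TangentSpace I x) (U : Set M) : Prop :=
  ContMDiffOn I (I.prod 𝓘(ℝ, E →L[ℝ] E)) ∞
    (fun x => Bundle.TotalSpace.mk' (E →L[ℝ] E)
      (E := fun x : M => TangentSpace I x →L[ℝ] TangentSpace I x) x (A x)) U

variable (M) in
/-- An almost CR structure `(HM, J)` of codimension `d` on `M`: a smooth subbundle `HM` of the
tangent bundle, of rank `dim M - d`, with a smooth bundle map `J : HM → HM` such that `J² = -id`.
A local section of `HM` is written as a family `X` with `X x ∈ HM_x` for every `x : M`; only its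
values on the open set `U` under consideration matter. -/
structure AlmostCRStructure (d : ℕ) where
  /-- the Levi distribution `HM` -/
  levi : ∀ x : M, Submodule ℝ (TangentSpace I x)
  /-- the endomorphism `J` of `HM` -/
  J : ∀ x : M, levi x →ₗ[ℝ] levi x
  /-- `HM` has codimension `d` -/
  codim : ∀ x : M, Module.finrank ℝ (levi x) + d = Module.finrank ℝ E
  /-- `HM` has smooth local frames -/
  exists_frame : ∀ x : M, ∃ U : Set M, IsOpen U ∧ x ∈ U ∧
    ∃ s : Fin (Module.finrank ℝ (levi x)) → ∀ y : M, levi y,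
      (∀ i, SmoothFieldOn I (fun y => (s i y : TangentSpace I y)) U) ∧
      ∀ y ∈ U, LinearIndependent ℝ (fun i => s i y) ∧
        Submodule.span ℝ (Set.range fun i => s i y) = ⊤
  /-- `J` maps smooth local sections of `HM` to smooth local sections -/
  smooth_J : ∀ (U : Set M), IsOpen U → ∀ X : ∀ y : M, levi y,
    SmoothFieldOn I (fun y => (X y : TangentSpace I y)) U →
    SmoothFieldOn I (fun y => (J y (X y) : TangentSpace I y)) U
  /-- `J² = -id` -/
  J_sq : ∀ (x : M) (X : levi x), J x (J x X) = -X

variable {I}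

/-- Integrability of an almost CR structure: for all smooth local sections `X`, `Y` of `HM`,
`[JX, Y] + [X, JY]` is a section of `HM`, and
`[JX, JY] - J ([JX, Y] + [X, JY]) - [X, Y] = 0`. -/
def AlmostCRStructure.IsIntegrable {d : ℕ} (C : AlmostCRStructure I M d) : Prop :=
  ∀ (U : Set M), IsOpen U → ∀ X Y : ∀ y : M, C.levi y,
    SmoothFieldOn I (fun y => (X y : TangentSpace I y)) U →
    SmoothFieldOn I (fun y => (Y y : TangentSpace I y)) U →
    ∀ x ∈ U,
      ∃ h : VectorField.mlieBracket I (fun y => (C.J y (X y) : TangentSpace I y))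
            (fun y => (Y y : TangentSpace I y)) x
          + VectorField.mlieBracket I (fun y => (X y : TangentSpace I y))
            (fun y => (C.J y (Y y) : TangentSpace I y)) x ∈ C.levi x,
        VectorField.mlieBracket I (fun y => (C.J y (X y) : TangentSpace I y))
            (fun y => (C.J y (Y y) : TangentSpace I y)) x
          - (C.J x ⟨_, h⟩ : TangentSpace I x)
          - VectorField.mlieBracket I (fun y => (X y : TangentSpace I y))
            (fun y => (Y y : TangentSpace I y)) x = 0

/-- A smooth map `f` between manifolds with almost CR structures is a CR map if
`df (HM) ⊆ HN` and `df ∘ J = J' ∘ df` on `HM`. -/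
def IsCRMap {E' : Type*} [NormedAddCommGroup E'] [NormedSpace ℝ E']
    {H' : Type*} [TopologicalSpace H'] {I' : ModelWithCorners ℝ E' H'}
    {N : Type*} [TopologicalSpace N] [ChartedSpace H' N] [IsManifold I' ∞ N] {d d' : ℕ}
    (C : AlmostCRStructure I M d) (C' : AlmostCRStructure I' N d') (f : M → N) : Prop :=
  ContMDiff I I' ∞ f ∧
    ∀ (x : M) (X : C.levi x), ∃ h : mfderiv I I' f x (X : TangentSpace I x) ∈ C'.levi (f x),
      mfderiv I I' f x (C.J x X : TangentSpace I x) = (C'.J (f x) ⟨_, h⟩ : TangentSpace I' (f x))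

/-! ### Lifts to the tangent bundle

A tangent vector to `TM` at `v`, with `v` over `x`, is a pair `(X, Y) : E × E`: its components with
respect to the coordinates `(x^i, y^i)` of `TM` induced by the preferred chart of `M` at `x`.
A tangent vector to `M` at `x` is likewise its vector of components in that chart. -/

/-- The vertical lift to `v` of a tangent vector at the base point: `z^i ∂/∂Y^i`. -/
def verticalLift (v : TangentBundle I M) (z : TangentSpace I v.proj) :
    TangentSpace I.tangent v :=
  ((0, z) : E × E)

/-- The component function `p ↦ (z^i(p))` of a vector field in the coordinate frame of the
preferred chart at `x`. -/
def fieldComponents (Z : ∀ y : M, TangentSpace I y) (x : M) (p : M) : E :=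
  (trivializationAt E (TangentSpace I) x ⟨p, Z p⟩).2

/-- The complete lift of a vector field: `z^i ∂/∂X^i + y^j (∂z^i/∂x^j) ∂/∂Y^i`. -/
def completeLift (Z : ∀ y : M, TangentSpace I y) (v : TangentBundle I M) :
    TangentSpace I.tangent v :=
  ((Z v.proj, mfderiv I 𝓘(ℝ, E) (fieldComponents Z v.proj) v.proj v.snd) : E × E)

/-- The component matrix `p ↦ (A_i^j(p))` of a `(1,1)`-tensor field in the coordinate frame of the
preferred chart at `x`. -/
def tensorComponents (A : ∀ y : M, TangentSpace I y →L[ℝ] TangentSpace I y) (x : M) (p : M) :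
    E →L[ℝ] E :=
  ContinuousLinearMap.inCoordinates E (TangentSpace I) E (TangentSpace I) x p x p (A p)

/-- The complete lift of a `(1,1)`-tensor field:
`A_i^j ∂/∂X^j ⊗ dX^i + y^k (∂A_i^j/∂x^k) ∂/∂Y^j ⊗ dX^i + A_i^j ∂/∂Y^j ⊗ dY^i`. -/
def completeLiftTensor (A : ∀ y : M, TangentSpace I y →L[ℝ] TangentSpace I y)
    (v : TangentBundle I M) (w : TangentSpace I.tangent v) : TangentSpace I.tangent v :=
  let a : E →L[ℝ] E := A v.proj
  let da : E →L[ℝ] E :=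
    mfderiv I 𝓘(ℝ, E →L[ℝ] E) (tensorComponents A v.proj) v.proj v.snd
  let w' : E × E := w
  ((a w'.1, da w'.1 + a w'.2) : E × E)

/-- The distribution `(HM)^V + (HM)^C` on `TM`, at `v`: the span of the values at `v` of the
vertical and of the complete lifts of the smooth local sections of `HM`. -/
def AlmostCRStructure.liftedLevi {d : ℕ} (C : AlmostCRStructure I M d) (v : TangentBundle I M) :
    Submodule ℝ (TangentSpace I.tangent v) :=
  Submodule.span ℝ {w | ∃ (U : Set M) (Z : ∀ y : M, C.levi y), IsOpen U ∧ v.proj ∈ U ∧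
    SmoothFieldOn I (fun y => (Z y : TangentSpace I y)) U ∧
    (w = verticalLift v (Z v.proj : TangentSpace I v.proj) ∨
      w = completeLift (fun y => (Z y : TangentSpace I y)) v)}

/-- The almost CR structure `C'` on `TM` is `((HM)^V + (HM)^C, J^C)`: its Levi distribution is
spanned by the vertical and complete lifts of sections of `HM`, its endomorphism is the
restriction of the complete lift `A^C` of every smooth (local) extension `A` of `J` to a
`(1,1)`-tensor field, and it maps `Z^V` to `(JZ)^V` and `Z^C` to `(JZ)^C`. -/
structure AlmostCRStructure.IsCompleteLift {d d' : ℕ} (C : AlmostCRStructure I M d)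
    (C' : AlmostCRStructure I.tangent (TangentBundle I M) d') : Prop where
  levi_eq : ∀ v : TangentBundle I M, C'.levi v = C.liftedLevi v
  J_eq : ∀ (U : Set M), IsOpen U →
    ∀ A : ∀ y : M, TangentSpace I y →L[ℝ] TangentSpace I y, SmoothTensorOn I A U →
    (∀ y ∈ U, ∀ X : C.levi y, A y (X : TangentSpace I y) = (C.J y X : TangentSpace I y)) →
    ∀ v : TangentBundle I M, v.proj ∈ U → ∀ w : C'.levi v,
      (C'.J v w : TangentSpace I.tangent v) =
        completeLiftTensor A v (w : TangentSpace I.tangent v)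
  J_lift : ∀ (U : Set M), IsOpen U → ∀ Z : ∀ y : M, C.levi y,
    SmoothFieldOn I (fun y => (Z y : TangentSpace I y)) U →
    ∀ v : TangentBundle I M, v.proj ∈ U → ∀ w : C'.levi v,
      ((w : TangentSpace I.tangent v) = verticalLift v (Z v.proj : TangentSpace I v.proj) →
        (C'.J v w : TangentSpace I.tangent v) =
          verticalLift v (C.J v.proj (Z v.proj) : TangentSpace I v.proj)) ∧
      ((w : TangentSpace I.tangent v) = completeLift (fun y => (Z y : TangentSpace I y)) v →
        (C'.J v w : TangentSpace I.tangent v) =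
          completeLift (fun y => (C.J y (Z y) : TangentSpace I y)) v)

end CRStructures

end

open Set Filter Topology VectorField

noncomputable section

/-! ### Complete lifts of vector fields and endomorphism fields on a normed space. -/

section Calculus

variable {E : Type*} [NormedAddCommGroup E] [NormedSpace ℝ E]

/-! Locally a CR structure is a pair of matrix fields. In a chart, let `P` be a smooth field of
projectors with range HM and let A = J∘P; then P² = P, PA = AP = A and A² = -P. Testing
integrability on the sections Pu and Pw with constant u, w turns it into identities between P, A and
their first derivatives, written with the bilinear expression `endBracket`. Conversely, these
identities give integrability for all sections, since the algebraic relations take care of the terms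
that differentiate the sections (`integrable_of_isIntegrableProjector`).

The complete lift of F is the block triangular matrix with F twice on the diagonal and, below it,
the derivative of F along the fibre coordinate y. By the Leibniz rule lifting is multiplicative
(`endLift_comp_of_eqOn`), so the algebraic relations pass to the lifts of P and A. By symmetry of
second derivatives, brackets of lifts are the complete lifts of the brackets (`endBracket_endLift`).
Differentiating the integrability identities along y therefore proves them for the lifts
(`isIntegrableProjector_endLift`).

To globalise, the range of the lifted projector is identified with the span of the Z^V and Z^C
(`mem_liftedLevi_iff`), of rank twice that of HM (`finrank_liftedLevi`). The lift of any F with F Z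
= JZ near a point sends Z^V to (JZ)^V and Z^C to (JZ)^C (`toCoord_lift`), and these lifts do not
depend on charts (`toCoord_verticalLift`, `toCoord_completeLift`). Hence the local lifts of J agree
on the span, whatever the chart and the extension. -/

/-- The complete lift of a vector field on a normed space: `(p, y) ↦ (f p, Df(p) y)`. -/
def tangentLift (f : E → E) (q : E × E) : E × E := (f q.1, fderiv ℝ f q.1 q.2)

/-- The complete lift of a field of endomorphisms of a normed space. -/
def endLift (F : E → E →L[ℝ] E) (q : E × E) : E × E →L[ℝ] E × E :=
  ((F q.1).comp (ContinuousLinearMap.fst ℝ E E)).prod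
    ((fderiv ℝ F q.1 q.2).comp (ContinuousLinearMap.fst ℝ E E)
      + (F q.1).comp (ContinuousLinearMap.snd ℝ E E))

lemma endLift_apply (F : E → E →L[ℝ] E) (q w : E × E) :
    endLift F q w = (F q.1 w.1, fderiv ℝ F q.1 q.2 w.1 + F q.1 w.2) := rfl

/-- The product rule: the two terms in the derivative of p ↦ F(p) f(p) are the two entries of the
lower block row of the lift. This is the source of J^C Z^C = (JZ)^C. -/
lemma tangentLift_clm_apply {F : E → E →L[ℝ] E} {f : E → E} {q : E × E}
    (hF : DifferentiableAt ℝ F q.1) (hf : DifferentiableAt ℝ f q.1) :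
    tangentLift (fun p => F p (f p)) q = endLift F q (tangentLift f q) := by
  simp only [tangentLift, endLift_apply]
  rw [fderiv_clm_apply hF hf]
  simp [add_comm]

lemma Filter.EventuallyEq.tangentLift_eq {f g : E → E} {q : E × E} (h : f =ᶠ[𝓝 q.1] g) :
    tangentLift f q = tangentLift g q := by
  simp only [tangentLift, h.fderiv_eq, h.eq_of_nhds]

lemma ContDiffAt.endLift {F : E → E →L[ℝ] E} {q : E × E} (hF : ContDiffAt ℝ ∞ F q.1) :
    ContDiffAt ℝ ∞ (endLift F) q := by
  have h1 : ContDiffAt ℝ ∞ (fun q : E × E => F q.1) q := hF.comp q contDiffAt_fst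
  have h2 : ContDiffAt ℝ ∞ (fun q : E × E => fderiv ℝ F q.1) q :=
    (hF.fderiv_right (m := ∞) le_rfl).comp q contDiffAt_fst
  have h3 := h2.clm_apply (contDiffAt_snd (n := ∞) (p := q))
  have h4 := h1.clm_comp (contDiffAt_const (c := ContinuousLinearMap.fst ℝ E E))
  have h5 := h1.clm_comp (contDiffAt_const (c := ContinuousLinearMap.snd ℝ E E))
  have h6 := h3.clm_comp (contDiffAt_const (c := ContinuousLinearMap.fst ℝ E E))
  exact (ContinuousLinearMap.prodₗᵢ ℝ : (E × E →L[ℝ] E) × (E × E →L[ℝ] E) ≃ₗᵢ[ℝ]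
    (E × E →L[ℝ] E × E)).toContinuousLinearEquiv.contDiff.contDiffAt.comp q (h4.prodMk (h6.add h5))

lemma fderiv_endLift_apply {F : E → E →L[ℝ] E} {q : E × E} (hF : ContDiffAt ℝ ∞ F q.1)
    (a w : E × E) :
    fderiv ℝ (endLift F) q a w = (fderiv ℝ F q.1 a.1 w.1,
      fderiv ℝ (fderiv ℝ F) q.1 a.1 q.2 w.1 + fderiv ℝ F q.1 a.2 w.1
        + fderiv ℝ F q.1 a.1 w.2) := by
  have hd : HasFDerivAt F (fderiv ℝ F q.1) q.1 :=
    (hF.differentiableAt (by simp)).hasFDerivAt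
  have hdd : HasFDerivAt (fderiv ℝ F) (fderiv ℝ (fderiv ℝ F) q.1) q.1 :=
    ((hF.fderiv_right (m := ∞) le_rfl).differentiableAt (by simp)).hasFDerivAt
  have hL : HasFDerivAt (endLift F) (fderiv ℝ (endLift F) q) q :=
    (hF.endLift.differentiableAt (by simp)).hasFDerivAt
  have e := hL.clm_apply (hasFDerivAt_const w q)
  have dfst : HasFDerivAt (fun q : E × E => q.1) (ContinuousLinearMap.fst ℝ E E) q := hasFDerivAt_fst
  have d1 : HasFDerivAt (fun q : E × E => F q.1) _ q := hd.comp q dfst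
  have d2 : HasFDerivAt (fun q : E × E => fderiv ℝ F q.1)
      ((fderiv ℝ (fderiv ℝ F) q.1).comp (ContinuousLinearMap.fst ℝ E E)) q :=
    HasFDerivAt.comp (𝕜 := ℝ) (E := E × E) (F := E) (G := E →L[ℝ] E →L[ℝ] E) q hdd dfst
  have d3 := (d1.clm_apply (hasFDerivAt_const w.1 q)).prodMk
    (((d2.clm_apply hasFDerivAt_snd).clm_apply (hasFDerivAt_const w.1 q)).add
      (d1.clm_apply (hasFDerivAt_const w.2 q)))
  have := congrArg (fun T => T a) (e.unique d3)
  simpa [add_comm, add_left_comm, add_assoc] using this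

/-- The value at `p` of the bracket of the fields `F u` and `G w`, for constant `u`, `w`. -/
def endBracket (F G : E → E →L[ℝ] E) (p u w : E) : E :=
  fderiv ℝ G p (F p u) w - fderiv ℝ F p (G p w) u

/-- The product rule isolates a part bilinear in the values X(p), Y(p). The two remaining terms,
which differentiate X and Y, are the ones that must disappear from the integrability condition. -/
lemma lieBracket_clm_apply {F G : E → E →L[ℝ] E} {X Y : E → E} {p : E}
    (hF : DifferentiableAt ℝ F p) (hG : DifferentiableAt ℝ G p)
    (hX : DifferentiableAt ℝ X p) (hY : DifferentiableAt ℝ Y p) :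
    lieBracket ℝ (fun p => F p (X p)) (fun p => G p (Y p)) p =
      endBracket F G p (X p) (Y p) + G p (fderiv ℝ Y p (F p (X p)))
        - F p (fderiv ℝ X p (G p (Y p))) := by
  simp only [lieBracket, endBracket, fderiv_clm_apply hF hX, fderiv_clm_apply hG hY]
  simp
  abel

lemma hasFDerivAt_endBracket {F G : E → E →L[ℝ] E} {p : E} (hF : ContDiffAt ℝ ∞ F p)
    (hG : ContDiffAt ℝ ∞ G p) (u w : E) :
    ∃ L : E →L[ℝ] E, HasFDerivAt (fun p => endBracket F G p u w) L p ∧ ∀ y, L y =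
      fderiv ℝ (fderiv ℝ G) p y (F p u) w + fderiv ℝ G p (fderiv ℝ F p y u) w
      - (fderiv ℝ (fderiv ℝ F) p y (G p w) u + fderiv ℝ F p (fderiv ℝ G p y w) u) := by
  have dF : HasFDerivAt F (fderiv ℝ F p) p := (hF.differentiableAt (by simp)).hasFDerivAt
  have dG : HasFDerivAt G (fderiv ℝ G p) p := (hG.differentiableAt (by simp)).hasFDerivAt
  have ddF : HasFDerivAt (fderiv ℝ F) (fderiv ℝ (fderiv ℝ F) p) p :=
    ((hF.fderiv_right (m := ∞) le_rfl).differentiableAt (by simp)).hasFDerivAt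
  have ddG : HasFDerivAt (fderiv ℝ G) (fderiv ℝ (fderiv ℝ G) p) p :=
    ((hG.fderiv_right (m := ∞) le_rfl).differentiableAt (by simp)).hasFDerivAt
  have e := ((ddG.clm_apply (dF.clm_apply (hasFDerivAt_const u p))).clm_apply
    (hasFDerivAt_const w p)).sub
    ((ddF.clm_apply (dG.clm_apply (hasFDerivAt_const w p))).clm_apply (hasFDerivAt_const u p))
  refine ⟨_, e, fun y => ?_⟩
  simp [add_comm]

/-- The right side is the complete lift of the bilinear field (u, w) ↦ `endBracket F G p u w`.
Second derivatives enter the left side with y in the second slot and the right side with y in the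
first, so their symmetry is exactly what is needed. -/
lemma endBracket_endLift {F G : E → E →L[ℝ] E} {q : E × E} (hF : ContDiffAt ℝ ∞ F q.1)
    (hG : ContDiffAt ℝ ∞ G q.1) (u w : E × E) :
    endBracket (endLift F) (endLift G) q u w = (endBracket F G q.1 u.1 w.1,
      fderiv ℝ (fun p => endBracket F G p u.1 w.1) q.1 q.2
        + endBracket F G q.1 u.2 w.1 + endBracket F G q.1 u.1 w.2) := by
  obtain ⟨L, hL, hLy⟩ := hasFDerivAt_endBracket hF hG u.1 w.1
  have sF : IsSymmSndFDerivAt ℝ F q.1 := hF.isSymmSndFDerivAt (by simpa using ENat.LEInfty.out)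
  have sG : IsSymmSndFDerivAt ℝ G q.1 := hG.isSymmSndFDerivAt (by simpa using ENat.LEInfty.out)
  rw [hL.fderiv, hLy]
  simp only [endBracket, fderiv_endLift_apply hF, fderiv_endLift_apply hG, endLift_apply]
  rw [sF.eq q.2 (G q.1 w.1), sG.eq q.2 (F q.1 u.1)]
  ext
  · simp
  · simp
    abel

/-! ### Complex projectors, their integrability, and their complete lifts. -/

/-- `P` is a smooth field of projectors on the open set `Ω`, and `A` a smooth field of
endomorphisms which vanishes on the kernel of `P` and is a complex structure on its range. -/
structure IsComplexProjector (Ω : Set E) (P A : E → E →L[ℝ] E) : Prop where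
  isOpen : IsOpen Ω
  smooth_proj : ∀ p ∈ Ω, ContDiffAt ℝ ∞ P p
  smooth_end : ∀ p ∈ Ω, ContDiffAt ℝ ∞ A p
  proj_proj : ∀ p ∈ Ω, ∀ u, P p (P p u) = P p u
  proj_end : ∀ p ∈ Ω, ∀ u, P p (A p u) = A p u
  end_proj : ∀ p ∈ Ω, ∀ u, A p (P p u) = A p u
  end_end : ∀ p ∈ Ω, ∀ u, A p (A p u) = -P p u

/-- The mixed term in the integrability condition of a complex projector. -/
def mixedBracket (P A : E → E →L[ℝ] E) (p u w : E) : E :=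
  endBracket A P p u w + endBracket P A p u w

/-- The integrability condition of a complex projector. -/
def IsIntegrableProjector (Ω : Set E) (P A : E → E →L[ℝ] E) : Prop :=
  ∀ p ∈ Ω, ∀ u w, P p (mixedBracket P A p u w) = mixedBracket P A p u w ∧
    endBracket A A p u w - A p (mixedBracket P A p u w) - endBracket P P p u w = 0

lemma fderiv_comp_of_eqOn {F G K : E → E →L[ℝ] E} {p : E} (hF : DifferentiableAt ℝ F p)
    (hG : DifferentiableAt ℝ G p) (h : ∀ᶠ p in 𝓝 p, ∀ u, F p (G p u) = K p u) (y u : E) :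
    fderiv ℝ K p y u = fderiv ℝ F p y (G p u) + F p (fderiv ℝ G p y u) := by
  have e : K =ᶠ[𝓝 p] fun p => (F p).comp (G p) := by
    filter_upwards [h] with p hp
    ext u
    exact (hp u).symm
  rw [e.fderiv_eq, (hF.hasFDerivAt.clm_comp hG.hasFDerivAt).fderiv]
  simp [add_comm]

/-- Block triangular matrices with F on the diagonal and its derivative below multiply by the
Leibniz rule. The relation is required near the point because it is differentiated once. -/
lemma endLift_comp_of_eqOn {F G K : E → E →L[ℝ] E} {q : E × E} (hF : DifferentiableAt ℝ F q.1)
    (hG : DifferentiableAt ℝ G q.1) (h : ∀ᶠ p in 𝓝 q.1, ∀ u, F p (G p u) = K p u)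
    (w : E × E) : endLift F q (endLift G q w) = endLift K q w := by
  have h0 := h.self_of_nhds
  simp only [endLift_apply, fderiv_comp_of_eqOn hF hG h, map_add, h0]
  simp only [add_assoc]

lemma endLift_neg (F : E → E →L[ℝ] E) (q w : E × E) :
    endLift (fun p => -F p) q w = -endLift F q w := by
  have : fderiv ℝ (fun p => -F p) q.1 = -fderiv ℝ F q.1 := fderiv_fun_neg
  simp only [endLift_apply, this]
  ext <;> simp [add_comm]

namespace IsComplexProjector

variable {Ω : Set E} {P A : E → E →L[ℝ] E}

lemma eventually_mem (h : IsComplexProjector Ω P A) {p : E} (hp : p ∈ Ω) : ∀ᶠ p in 𝓝 p, p ∈ Ω :=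
  h.isOpen.mem_nhds hp

lemma differentiableAt_proj (h : IsComplexProjector Ω P A) {p : E} (hp : p ∈ Ω) :
    DifferentiableAt ℝ P p := (h.smooth_proj p hp).differentiableAt (by simp)

lemma differentiableAt_end (h : IsComplexProjector Ω P A) {p : E} (hp : p ∈ Ω) :
    DifferentiableAt ℝ A p := (h.smooth_end p hp).differentiableAt (by simp)

lemma endLift (h : IsComplexProjector Ω P A) :
    IsComplexProjector (Prod.fst ⁻¹' Ω) (endLift P) (endLift A) where
  isOpen := h.isOpen.preimage continuous_fst
  smooth_proj q hq := (h.smooth_proj q.1 hq).endLift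
  smooth_end q hq := (h.smooth_end q.1 hq).endLift
  proj_proj q hq := endLift_comp_of_eqOn (h.differentiableAt_proj hq)
    (h.differentiableAt_proj hq) ((h.eventually_mem hq).mono h.proj_proj)
  proj_end q hq := endLift_comp_of_eqOn (h.differentiableAt_proj hq)
    (h.differentiableAt_end hq) ((h.eventually_mem hq).mono h.proj_end)
  end_proj q hq := endLift_comp_of_eqOn (h.differentiableAt_end hq)
    (h.differentiableAt_proj hq) ((h.eventually_mem hq).mono h.end_proj)
  end_end q hq u := by
    rw [endLift_comp_of_eqOn (K := fun p => -P p) (h.differentiableAt_end hq)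
      (h.differentiableAt_end hq) ((h.eventually_mem hq).mono h.end_end), endLift_neg]

lemma differentiableAt_mixedBracket (h : IsComplexProjector Ω P A) {p : E} (hp : p ∈ Ω) (u w : E) :
    DifferentiableAt ℝ (fun p => mixedBracket P A p u w) p := by
  obtain ⟨_, h1, -⟩ := hasFDerivAt_endBracket (h.smooth_end p hp) (h.smooth_proj p hp) u w
  obtain ⟨_, h2, -⟩ := hasFDerivAt_endBracket (h.smooth_proj p hp) (h.smooth_end p hp) u w
  exact h1.differentiableAt.add h2.differentiableAt

lemma mixedBracket_endLift (h : IsComplexProjector Ω P A) {q : E × E} (hq : q.1 ∈ Ω) (u w : E × E) :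
    mixedBracket (_root_.endLift P) (_root_.endLift A) q u w =
      (mixedBracket P A q.1 u.1 w.1,
        fderiv ℝ (fun p => mixedBracket P A p u.1 w.1) q.1 q.2
          + mixedBracket P A q.1 u.2 w.1 + mixedBracket P A q.1 u.1 w.2) := by
  obtain ⟨_, h1, -⟩ := hasFDerivAt_endBracket (h.smooth_end q.1 hq) (h.smooth_proj q.1 hq) u.1 w.1
  obtain ⟨_, h2, -⟩ := hasFDerivAt_endBracket (h.smooth_proj q.1 hq) (h.smooth_end q.1 hq) u.1 w.1
  have e : fderiv ℝ (fun p => mixedBracket P A p u.1 w.1) q.1 = _ := (h1.add h2).fderiv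
  rw [e, mixedBracket, endBracket_endLift (h.smooth_end q.1 hq) (h.smooth_proj q.1 hq),
    endBracket_endLift (h.smooth_proj q.1 hq) (h.smooth_end q.1 hq), h1.fderiv, h2.fderiv]
  ext
  · simp [mixedBracket]
  · simp [mixedBracket]
    abel

/-- The complete lift of an integrable complex projector is integrable. -/
lemma isIntegrableProjector_endLift (h : IsComplexProjector Ω P A)
    (hi : IsIntegrableProjector Ω P A) :
    IsIntegrableProjector (Prod.fst ⁻¹' Ω) (_root_.endLift P) (_root_.endLift A) := by
  intro q hq u w
  have hq : q.1 ∈ Ω := hq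
  have dm := h.differentiableAt_mixedBracket hq u.1 w.1
  have ev := h.eventually_mem hq
  obtain ⟨_, hA, -⟩ := hasFDerivAt_endBracket (h.smooth_end q.1 hq) (h.smooth_end q.1 hq) u.1 w.1
  obtain ⟨_, hP, -⟩ := hasFDerivAt_endBracket (h.smooth_proj q.1 hq) (h.smooth_proj q.1 hq) u.1 w.1
  rw [h.mixedBracket_endLift hq, endBracket_endLift (h.smooth_end q.1 hq) (h.smooth_end q.1 hq),
    endBracket_endLift (h.smooth_proj q.1 hq) (h.smooth_proj q.1 hq)]
  constructor
  -- The first component is the old identity. The second is its derivative along `q.2`, together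
  -- with the identity itself for the pairs (u.2, w.1) and (u.1, w.2).
  · have e : (fun p => P p (mixedBracket P A p u.1 w.1)) =ᶠ[𝓝 q.1]
        fun p => mixedBracket P A p u.1 w.1 := ev.mono fun p hp => (hi p hp _ _).1
    have e' := congrArg (fun T : E →L[ℝ] E => T q.2) e.fderiv_eq
    simp only [fderiv_clm_apply (h.differentiableAt_proj hq) dm] at e'
    rw [endLift_apply]
    ext
    · exact (hi _ hq _ _).1
    · simp only [map_add, (hi _ hq _ _).1]
      conv_rhs => rw [← e']
      simp
      abel
  · have e : (fun p => endBracket A A p u.1 w.1 - A p (mixedBracket P A p u.1 w.1)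
        - endBracket P P p u.1 w.1) =ᶠ[𝓝 q.1] fun p => 0 := ev.mono fun p hp => (hi p hp _ _).2
    have d := (hA.sub ((h.differentiableAt_end hq).hasFDerivAt.clm_apply dm.hasFDerivAt)).sub hP
    have e' := congrArg (fun T : E →L[ℝ] E => T q.2) (d.fderiv.symm.trans e.fderiv_eq)
    have i1 := (hi _ hq u.2 w.1).2
    have i2 := (hi _ hq u.1 w.2).2
    rw [hA.fderiv, hP.fderiv, endLift_apply]
    ext
    · exact (hi _ hq _ _).2
    · simp at e'
      simp only [Prod.snd_sub, Prod.snd_zero, map_add]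
      -- The zero on the right is split in three; each copy is replaced by one known identity: the
      -- derivative `e'`, then `i1`, then `i2`.
      rw [← add_zero (0 : E), ← add_zero ((0 : E) + 0)]
      nth_rewrite 1 [← e']
      nth_rewrite 1 [← i1]
      rw [← i2]
      abel

/-- Integrability of a complex projector is tensorial. -/
lemma integrable_of_isIntegrableProjector (h : IsComplexProjector Ω P A)
    (hi : IsIntegrableProjector Ω P A) {p : E} (hp : p ∈ Ω) {X Y : E → E}
    (hX : DifferentiableAt ℝ X p) (hY : DifferentiableAt ℝ Y p)
    (hPX : ∀ᶠ p in 𝓝 p, P p (X p) = X p) (hPY : ∀ᶠ p in 𝓝 p, P p (Y p) = Y p) :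
    P p (lieBracket ℝ (fun p => A p (X p)) Y p + lieBracket ℝ X (fun p => A p (Y p)) p) =
        lieBracket ℝ (fun p => A p (X p)) Y p + lieBracket ℝ X (fun p => A p (Y p)) p ∧
      lieBracket ℝ (fun p => A p (X p)) (fun p => A p (Y p)) p
        - A p (lieBracket ℝ (fun p => A p (X p)) Y p + lieBracket ℝ X (fun p => A p (Y p)) p)
        - lieBracket ℝ X Y p = 0 := by
  have dP := h.differentiableAt_proj hp
  have dA := h.differentiableAt_end hp
  -- Writing X as PX and Y as PY near p puts every bracket in the form [FX, GY]. The derivatives of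
  -- X and Y then appear only behind P or A: in the first identity P fixes these terms, in the
  -- second they cancel because AP = A and A² = -P.
  have eX : X =ᶠ[𝓝 p] fun p => P p (X p) := hPX.mono fun _ h => h.symm
  have eY : Y =ᶠ[𝓝 p] fun p => P p (Y p) := hPY.mono fun _ h => h.symm
  have r : ∀ Z : E → E, Z =ᶠ[𝓝 p] Z := fun Z => EventuallyEq.refl _ _
  have b1 : lieBracket ℝ (fun p => A p (X p)) Y p = _ :=
    ((r _).lieBracket_vectorField_eq eY).trans (lieBracket_clm_apply dA dP hX hY)
  have b2 : lieBracket ℝ X (fun p => A p (Y p)) p = _ :=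
    (eX.lieBracket_vectorField_eq (r _)).trans (lieBracket_clm_apply dP dA hX hY)
  have b3 : lieBracket ℝ X Y p = _ :=
    (eX.lieBracket_vectorField_eq eY).trans (lieBracket_clm_apply dP dP hX hY)
  obtain ⟨i1, i2⟩ := hi p hp (X p) (Y p)
  have x0 := hPX.self_of_nhds
  have y0 := hPY.self_of_nhds
  rw [b1, b2, b3, lieBracket_clm_apply dA dA hX hY, x0, y0]
  simp only [mixedBracket, map_add] at i1 i2
  simp only [map_add, map_sub, h.proj_proj p hp, h.proj_end p hp, h.end_proj p hp, h.end_end p hp]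
  constructor
  · rw [← sub_eq_zero] at i1 ⊢
    rw [← i1]
    abel
  · rw [← i2]
    abel

lemma lieBracket_clm_apply_const {F G : E → E →L[ℝ] E} {p : E} (hF : DifferentiableAt ℝ F p)
    (hG : DifferentiableAt ℝ G p) (u w : E) :
    lieBracket ℝ (fun p => F p u) (fun p => G p w) p = endBracket F G p u w := by
  rw [lieBracket_clm_apply hF hG (differentiableAt_const u) (differentiableAt_const w)]
  simp

end IsComplexProjector

end Calculus

/-! ### Complete lifts under a change of coordinates. -/

section ChartCalculus

variable {E : Type*} [NormedAddCommGroup E] [NormedSpace ℝ E]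

lemma hasFDerivAt_tangentLift {τ : E → E} {q : E × E} (hτ : ContDiffAt ℝ ∞ τ q.1) :
    ∃ L : E × E →L[ℝ] E × E, HasFDerivAt (tangentLift τ) L q ∧ ∀ w, L w =
      (fderiv ℝ τ q.1 w.1, fderiv ℝ (fderiv ℝ τ) q.1 w.1 q.2 + fderiv ℝ τ q.1 w.2) := by
  have dfst : HasFDerivAt (fun q : E × E => q.1) (ContinuousLinearMap.fst ℝ E E) q :=
    hasFDerivAt_fst
  have d1 : HasFDerivAt (fun q : E × E => τ q.1)
      ((fderiv ℝ τ q.1).comp (ContinuousLinearMap.fst ℝ E E)) q :=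
    (hτ.differentiableAt (by simp)).hasFDerivAt.comp q dfst
  have hdd : HasFDerivAt (fderiv ℝ τ) (fderiv ℝ (fderiv ℝ τ) q.1) q.1 :=
    ((hτ.fderiv_right (m := ∞) le_rfl).differentiableAt (by simp)).hasFDerivAt
  have d2 : HasFDerivAt (fun q : E × E => fderiv ℝ τ q.1)
      ((fderiv ℝ (fderiv ℝ τ) q.1).comp (ContinuousLinearMap.fst ℝ E E)) q :=
    HasFDerivAt.comp (𝕜 := ℝ) (E := E × E) (F := E) (G := E →L[ℝ] E) q hdd dfst
  refine ⟨_, d1.prodMk (d2.clm_apply hasFDerivAt_snd), fun w => ?_⟩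
  simp [add_comm]

/-- Complete lifts of vector fields are compatible with changes of coordinates. -/
lemma fderiv_tangentLift_tangentLift {τ f g : E → E} {q : E × E} (hτ : ContDiffAt ℝ ∞ τ q.1)
    (hf : DifferentiableAt ℝ f q.1) (hg : DifferentiableAt ℝ g (τ q.1))
    (h : ∀ᶠ p in 𝓝 q.1, g (τ p) = fderiv ℝ τ p (f p)) :
    fderiv ℝ (tangentLift τ) q (tangentLift f q) = tangentLift g (tangentLift τ q) := by
  obtain ⟨L, hL, hLw⟩ := hasFDerivAt_tangentLift hτ
  have dτ := hτ.differentiableAt (by simp)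
  have ddτ := (hτ.fderiv_right (m := ∞) le_rfl).differentiableAt (by simp)
  have s : IsSymmSndFDerivAt ℝ τ q.1 :=
    hτ.isSymmSndFDerivAt (by simpa using ENat.LEInfty.out)
  -- The transformation law g∘τ = Dτ·f is differentiated along the fibre coordinate; symmetry of the
  -- second derivative of τ then matches the result with the derivative of `tangentLift τ`.
  have e : fderiv ℝ (fun p => g (τ p)) q.1 q.2 = fderiv ℝ (fun p => fderiv ℝ τ p (f p)) q.1 q.2 :=
    congrArg (fun T : E →L[ℝ] E => T q.2) (EventuallyEq.fderiv_eq h)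
  rw [fderiv_clm_apply ddτ hf] at e
  have e1 : fderiv ℝ (fun p => g (τ p)) q.1 = (fderiv ℝ g (τ q.1)).comp (fderiv ℝ τ q.1) :=
    (hg.hasFDerivAt.comp q.1 dτ.hasFDerivAt).fderiv
  rw [e1] at e
  rw [hL.fderiv, hLw]
  ext
  · exact h.self_of_nhds.symm
  · simp only [tangentLift]
    simp only [ContinuousLinearMap.comp_apply, add_apply,
      ContinuousLinearMap.flip_apply] at e
    rw [e, s.eq q.2 (f q.1), add_comm]

end ChartCalculus

/-! ### Vector fields, brackets and transition maps in the preferred charts of a manifold. -/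

section Charts

variable {E : Type*} [NormedAddCommGroup E] [NormedSpace ℝ E]
  {H : Type*} [TopologicalSpace H] (I : ModelWithCorners ℝ E H)
  {M : Type*} [TopologicalSpace M] [ChartedSpace H M] [IsManifold I ∞ M]

/-- The components at `y` of a tangent vector in the preferred chart at `x`. -/
def toCoord (x y : M) : TangentSpace I y →L[ℝ] E :=
  let f : E →L[ℝ] E := tangentCoordChange I y x y
  f

/-- The tangent vector at `y` with given components in the preferred chart at `x`. -/
def ofCoord (x y : M) : E →L[ℝ] TangentSpace I y :=
  let f : E →L[ℝ] E := tangentCoordChange I x y y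
  f

/-- The expression of a vector field in the preferred chart at `x`. -/
def coordField (x : M) (X : ∀ y : M, TangentSpace I y) (p : E) : E :=
  toCoord I x ((extChartAt I x).symm p) (X ((extChartAt I x).symm p))

variable {I}

lemma ofCoord_toCoord {x y : M} (hy : y ∈ (extChartAt I x).source) (z : TangentSpace I y) :
    ofCoord I x y (toCoord I x y z) = z :=
  (tangentCoordChange_comp ⟨⟨mem_extChartAt_source y, hy⟩, mem_extChartAt_source y⟩).trans
    (tangentCoordChange_self (mem_extChartAt_source y))

lemma toCoord_ofCoord {x y : M} (hy : y ∈ (extChartAt I x).source) (u : E) :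
    toCoord I x y (ofCoord I x y u) = u :=
  (tangentCoordChange_comp ⟨⟨hy, mem_extChartAt_source y⟩, hy⟩).trans
    (tangentCoordChange_self hy)

lemma toCoord_injective {x y : M} (hy : y ∈ (extChartAt I x).source) :
    Function.Injective (toCoord I x y) :=
  Function.LeftInverse.injective (ofCoord_toCoord hy)

lemma toCoord_self (x : M) (z : TangentSpace I x) : toCoord I x x z = z :=
  tangentCoordChange_self (mem_extChartAt_source x)

lemma coordField_extChartAt {x y : M} (hy : y ∈ (extChartAt I x).source)
    (X : ∀ y : M, TangentSpace I y) :
    coordField I x X (extChartAt I x y) = toCoord I x y (X y) := by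
  rw [coordField, (extChartAt I x).left_inv hy]

lemma coordField_self (x : M) (X : ∀ y : M, TangentSpace I y) :
    coordField I x X (extChartAt I x x) = X x := by
  rw [coordField_extChartAt (mem_extChartAt_source x), toCoord_self]

lemma toCoord_eq_mfderiv {x y : M} (hy : y ∈ (extChartAt I x).source) :
    toCoord I x y = mfderiv I 𝓘(ℝ, E) (extChartAt I x) y := by
  rw [extChartAt_source] at hy
  rw [← TangentBundle.continuousLinearMapAt_trivializationAt hy,
    TangentBundle.continuousLinearMapAt_trivializationAt_eq_core hy]
  rfl

variable [I.Boundaryless]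

lemma contMDiffAt_iff_contDiffAt_comp_extChartAt_symm {F : Type*} [NormedAddCommGroup F]
    [NormedSpace ℝ F] {x y : M} (hy : y ∈ (extChartAt I x).source) {f : M → F} :
    ContMDiffAt I 𝓘(ℝ, F) ∞ f y ↔
      ContDiffAt ℝ ∞ (f ∘ (extChartAt I x).symm) (extChartAt I x y) := by
  rw [extChartAt_source] at hy
  rw [contMDiffAt_iff_source_of_mem_source hy, I.range_eq_univ, contMDiffWithinAt_univ,
    contMDiffAt_iff_contDiffAt]

lemma contMDiffAt_field_iff {x y : M} (hy : y ∈ (extChartAt I x).source)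
    {X : ∀ y : M, TangentSpace I y} :
    ContMDiffAt I I.tangent ∞ (fun y => (⟨y, X y⟩ : TangentBundle I M)) y ↔
      ContDiffAt ℝ ∞ (coordField I x X) (extChartAt I x y) := by
  refine Iff.trans ?_
    (contMDiffAt_iff_contDiffAt_comp_extChartAt_symm (f := fun y => toCoord I x y (X y)) hy)
  rw [extChartAt_source] at hy
  exact Bundle.Trivialization.contMDiffAt_section_iff (trivializationAt E (TangentSpace I) x) hy

lemma SmoothFieldOn.contDiffAt {X : ∀ y : M, TangentSpace I y} {U : Set M}
    (hX : SmoothFieldOn I X U) (hU : IsOpen U) {x y : M} (hy : y ∈ (extChartAt I x).source)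
    (hyU : y ∈ U) : ContDiffAt ℝ ∞ (coordField I x X) (extChartAt I x y) :=
  (contMDiffAt_field_iff hy).1 ((hX y hyU).contMDiffAt (hU.mem_nhds hyU))

/-- The derivatives of the chart and of its inverse are two-sided inverses of each other, so pulling
back along the inverse chart means taking components. This makes the naturality of the Lie bracket
usable in coordinates. -/
lemma mpullback_extChartAt_symm {x : M} {p : E} (hp : p ∈ (extChartAt I x).target)
    (X : ∀ y : M, TangentSpace I y) :
    mpullback 𝓘(ℝ, E) I (extChartAt I x).symm X p = coordField I x X p := by
  have hs := (extChartAt I x).map_target hp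
  have h1 := mfderiv_extChartAt_comp_mfderivWithin_extChartAt_symm (I := I) hp
  have h2 := mfderivWithin_extChartAt_symm_comp_mfderiv_extChartAt (I := I) hp
  rw [I.range_eq_univ, mfderivWithin_univ] at h1 h2
  rw [mpullback_apply, ContinuousLinearMap.inverse_eq h2 h1, coordField, toCoord_eq_mfderiv hs]
  rfl

/-- The Lie bracket of vector fields, computed in a chart. -/
lemma toCoord_mlieBracket [CompleteSpace E] {x y : M} (hy : y ∈ (extChartAt I x).source)
    {X Y : ∀ y : M, TangentSpace I y}
    (hX : ContMDiffAt I I.tangent ∞ (fun y => (⟨y, X y⟩ : TangentBundle I M)) y)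
    (hY : ContMDiffAt I I.tangent ∞ (fun y => (⟨y, Y y⟩ : TangentBundle I M)) y) :
    toCoord I x y (mlieBracket I X Y y) =
      lieBracket ℝ (coordField I x X) (coordField I x Y) (extChartAt I x y) := by
  have : IsManifold I (minSmoothness ℝ 2) M := by
    rw [minSmoothness_of_isRCLikeNormedField]; infer_instance
  have : IsManifold I (minSmoothness ℝ 3) M := by
    rw [minSmoothness_of_isRCLikeNormedField]; exact IsManifold.of_le (n := ∞) ENat.LEInfty.out
  have ht := (extChartAt I x).map_source hy
  have hl := (extChartAt I x).left_inv hy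
  have hφ : ContMDiffAt 𝓘(ℝ, E) I ∞ (extChartAt I x).symm (extChartAt I x y) :=
    ((contMDiffOn_extChartAt_symm x) _ ht).contMDiffAt
      ((isOpen_extChartAt_target x).mem_nhds ht)
  have key := mpullback_mlieBracket (I := 𝓘(ℝ, E)) (I' := I) (f := (extChartAt I x).symm)
    (V := X) (W := Y) (x₀ := extChartAt I x y) (n := ∞)
    (by rw [hl]; exact hX.mdifferentiableAt (by simp))
    (by rw [hl]; exact hY.mdifferentiableAt (by simp)) hφ
    (by rw [minSmoothness_of_isRCLikeNormedField]; exact ENat.LEInfty.out)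
  rw [mpullback_extChartAt_symm ht, coordField_extChartAt hy] at key
  rw [key]
  have ev : ∀ X : ∀ y : M, TangentSpace I y, mpullback 𝓘(ℝ, E) I (extChartAt I x).symm X
      =ᶠ[𝓝 (extChartAt I x y)] coordField I x X := fun X =>
    (eventually_of_mem ((isOpen_extChartAt_target x).mem_nhds ht)
      fun p hp => mpullback_extChartAt_symm hp X)
  refine ((ev X).mlieBracket_vectorField_eq (ev Y)).trans ?_
  refine (congrFun mlieBracketWithin_univ.symm _).trans ?_
  exact (congrFun mlieBracketWithin_eq_lieBracketWithin _).trans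
    (congrFun (lieBracketWithin_univ (𝕜 := ℝ) (E := E)) _)

/-- The changes of coordinates between preferred charts are smooth. -/
lemma contDiffAt_coordChange {x x' y : M} (hx : y ∈ (extChartAt I x).source)
    (hx' : y ∈ (extChartAt I x').source) :
    ContDiffAt ℝ ∞ (extChartAt I x' ∘ (extChartAt I x).symm) (extChartAt I x y) := by
  have := contDiffWithinAt_ext_coord_change (I := I) (n := ∞) x' x (y := extChartAt I x y)
    ⟨(extChartAt I x).map_source hx, by
      rwa [mem_preimage, PartialEquiv.symm_symm, (extChartAt I x).left_inv hx]⟩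
  rwa [I.range_eq_univ, contDiffWithinAt_univ] at this

lemma tangentCoordChange_eq_fderiv (x x' y : M) : tangentCoordChange I x x' y =
    fderiv ℝ (extChartAt I x' ∘ (extChartAt I x).symm) (extChartAt I x y) := by
  rw [tangentCoordChange_def, I.range_eq_univ, fderivWithin_univ]

lemma coordField_coordChange {x x' : M} {p : E} (hp : p ∈ (extChartAt I x).target)
    (hp' : (extChartAt I x).symm p ∈ (extChartAt I x').source) (X : ∀ y : M, TangentSpace I y) :
    coordField I x' X ((extChartAt I x' ∘ (extChartAt I x).symm) p) =
      fderiv ℝ (extChartAt I x' ∘ (extChartAt I x).symm) p (coordField I x X p) := by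
  have hs := (extChartAt I x).map_target hp
  have e := tangentCoordChange_eq_fderiv (I := I) x x' ((extChartAt I x).symm p)
  rw [(extChartAt I x).right_inv hp] at e
  rw [← e, Function.comp_apply, coordField_extChartAt hp']
  exact (tangentCoordChange_comp ⟨⟨mem_extChartAt_source _, hs⟩, hp'⟩).symm

end Charts

/-! ### Induced charts of the tangent bundle, and lifts expressed in them. -/

section TangentBundleCharts

variable {E : Type*} [NormedAddCommGroup E] [NormedSpace ℝ E]
  {H : Type*} [TopologicalSpace H] {I : ModelWithCorners ℝ E H}
  {M : Type*} [TopologicalSpace M] [ChartedSpace H M] [IsManifold I ∞ M]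

lemma extChartAt_tangent_apply (v w : TangentBundle I M) : extChartAt I.tangent v w =
    (extChartAt I v.proj w.proj, toCoord I v.proj w.proj w.snd) := rfl

lemma extChartAt_tangent_symm_apply (v : TangentBundle I M) (q : E × E) :
    (extChartAt I.tangent v).symm q = ⟨(extChartAt I v.proj).symm q.1,
      ofCoord I v.proj ((extChartAt I v.proj).symm q.1) q.2⟩ := by
  rfl

lemma mem_extChartAt_tangent_source {v w : TangentBundle I M} :
    w ∈ (extChartAt I.tangent v).source ↔ w.proj ∈ (extChartAt I v.proj).source := by
  rw [extChartAt_source, extChartAt_source]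
  exact TangentBundle.mem_chart_source_iff w v

lemma extChartAt_tangent_self (v : TangentBundle I M) : extChartAt I.tangent v v =
    (extChartAt I v.proj v.proj, v.snd) := by
  rw [extChartAt_tangent_apply, toCoord_self]
  rfl

variable [I.Boundaryless]

/-- Transition maps of the tangent bundle act on the fibres by the Jacobian of the transition map
below. -/
lemma tangent_coordChange_eventuallyEq {v w : TangentBundle I M}
    (h : v.proj ∈ (extChartAt I w.proj).source) :
    (extChartAt I.tangent w ∘ (extChartAt I.tangent v).symm) =ᶠ[𝓝 (extChartAt I.tangent v v)]
      tangentLift (extChartAt I w.proj ∘ (extChartAt I v.proj).symm) := by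
  have ht : extChartAt I v.proj v.proj ∈ (extChartAt I v.proj).target :=
    mem_extChartAt_target v.proj
  have hn : (extChartAt I v.proj).target ∩
      (extChartAt I v.proj).symm ⁻¹' (extChartAt I w.proj).source ∈
        𝓝 (extChartAt I v.proj v.proj) :=
    inter_mem ((isOpen_extChartAt_target v.proj).mem_nhds ht)
      ((continuousAt_extChartAt_symm v.proj).preimage_mem_nhds (by
        rw [extChartAt_to_inv]
        exact (isOpen_extChartAt_source w.proj).mem_nhds h))
  have hn' : ∀ᶠ q : E × E in 𝓝 (extChartAt I v.proj v.proj, v.snd), q.1 ∈ _ :=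
    continuousAt_fst.eventually_mem hn
  rw [extChartAt_tangent_self]
  filter_upwards [hn'] with q hq
  have hs := (extChartAt I v.proj).map_target hq.1
  have e := tangentCoordChange_eq_fderiv (I := I) v.proj w.proj ((extChartAt I v.proj).symm q.1)
  rw [(extChartAt I v.proj).right_inv hq.1] at e
  rw [Function.comp_apply, extChartAt_tangent_symm_apply, extChartAt_tangent_apply, tangentLift,
    ← e]
  exact Prod.ext rfl (tangentCoordChange_comp ⟨⟨hs, mem_extChartAt_source _⟩, hq.2⟩)

lemma toCoord_tangent {v w : TangentBundle I M} (h : v.proj ∈ (extChartAt I w.proj).source)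
    (z : TangentSpace I.tangent v) : toCoord I.tangent w v z =
      fderiv ℝ (tangentLift (extChartAt I w.proj ∘ (extChartAt I v.proj).symm))
        (extChartAt I v.proj v.proj, v.snd) z := by
  have e := tangentCoordChange_eq_fderiv (I := I.tangent) v w v
  rw [(tangent_coordChange_eventuallyEq h).fderiv_eq, extChartAt_tangent_self] at e
  exact congrArg (fun T : E × E →L[ℝ] E × E => T z) e

/-- The second derivative of the transition map is contracted with the horizontal component, which
is zero here; only the Jacobian remains. -/
lemma toCoord_verticalLift {v w : TangentBundle I M} (h : v.proj ∈ (extChartAt I w.proj).source)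
    (z : TangentSpace I v.proj) : toCoord I.tangent w v (verticalLift v z) =
      ((0, toCoord I w.proj v.proj z) : E × E) := by
  obtain ⟨L, hL, hLw⟩ := hasFDerivAt_tangentLift (q := (extChartAt I v.proj v.proj, v.snd))
    (contDiffAt_coordChange (mem_extChartAt_source v.proj) h)
  have e := tangentCoordChange_eq_fderiv (I := I) v.proj w.proj v.proj
  rw [toCoord_tangent h, hL.fderiv]
  refine (hLw _).trans ?_
  rw [← e]
  refine Prod.ext ?_ ?_
  · exact map_zero (tangentCoordChange I v.proj w.proj v.proj)
  · simp only [verticalLift, map_zero]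
    exact zero_add (tangentCoordChange I v.proj w.proj v.proj z)

lemma completeLift_eq_tangentLift (Z : ∀ y : M, TangentSpace I y) (v : TangentBundle I M)
    (hZ : ContMDiffAt I I.tangent ∞ (fun y => (⟨y, Z y⟩ : TangentBundle I M)) v.proj) :
    completeLift Z v = (tangentLift (coordField I v.proj Z) (extChartAt I v.proj v.proj, v.snd)) := by
  have hf := (Bundle.contMDiffAt_section v.proj).1 hZ
  have e := (hf.mdifferentiableAt (by simp)).mfderiv
  rw [I.range_eq_univ, fderivWithin_univ] at e
  refine Prod.ext (coordField_self v.proj Z).symm ?_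
  exact congrArg (fun T : E →L[ℝ] E => T v.snd) e

/-- `completeLift` is defined in the chart centred at `v.proj`. The transformation law of complete
lifts gives the same formula in every chart around that point, so one chart at `w` can describe a
whole neighbourhood. -/
lemma toCoord_completeLift {v w : TangentBundle I M} (h : v.proj ∈ (extChartAt I w.proj).source)
    {Z : ∀ y : M, TangentSpace I y}
    (hZ : ContMDiffAt I I.tangent ∞ (fun y => (⟨y, Z y⟩ : TangentBundle I M)) v.proj) :
    toCoord I.tangent w v (completeLift Z v) =
      tangentLift (coordField I w.proj Z) (extChartAt I.tangent w v) := by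
  have hs := mem_extChartAt_source (I := I) v.proj
  have ht := mem_extChartAt_target (I := I) v.proj
  have e := (tangent_coordChange_eventuallyEq h).self_of_nhds
  rw [Function.comp_apply, extChartAt_to_inv, extChartAt_tangent_self] at e
  rw [toCoord_tangent h, completeLift_eq_tangentLift Z v hZ, e]
  refine fderiv_tangentLift_tangentLift (contDiffAt_coordChange hs h)
    (((contMDiffAt_field_iff hs).1 hZ).differentiableAt (by simp)) ?_ ?_
  · rw [Function.comp_apply, extChartAt_to_inv]
    exact ((contMDiffAt_field_iff h).1 hZ).differentiableAt (by simp)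
  · filter_upwards [(isOpen_extChartAt_target v.proj).mem_nhds ht,
      (continuousAt_extChartAt_symm v.proj).preimage_mem_nhds (by
        rw [extChartAt_to_inv]
        exact (isOpen_extChartAt_source w.proj).mem_nhds h)] with p hp hp'
    exact coordField_coordChange hp hp' Z

end TangentBundleCharts

/-! ### Almost CR structures represented by complex projectors in charts. -/

section LocalRepresentation

variable {E : Type*} [NormedAddCommGroup E] [NormedSpace ℝ E]
  {H : Type*} [TopologicalSpace H] {I : ModelWithCorners ℝ E H}
  {M : Type*} [TopologicalSpace M] [ChartedSpace H M] [IsManifold I ∞ M]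

/-- In the preferred chart at `x`, over the open set `Ω`, the distribution `levi` is the range of
the projector `P`, and `J` is the restriction of `A`. -/
structure IsLocalRep (levi : ∀ y : M, Submodule ℝ (TangentSpace I y))
    (J : ∀ y : M, levi y →ₗ[ℝ] levi y) (x : M) (Ω : Set E) (P A : E → E →L[ℝ] E) : Prop
    extends IsComplexProjector Ω P A where
  subset_target : Ω ⊆ (extChartAt I x).target
  mem_iff : ∀ y ∈ (extChartAt I x).source, extChartAt I x y ∈ Ω → ∀ z : TangentSpace I y,
    z ∈ levi y ↔ P (extChartAt I x y) (toCoord I x y z) = toCoord I x y z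
  toCoord_J : ∀ y ∈ (extChartAt I x).source, extChartAt I x y ∈ Ω → ∀ z : levi y,
    toCoord I x y (J y z) = A (extChartAt I x y) (toCoord I x y z)

namespace IsLocalRep

variable {levi : ∀ y : M, Submodule ℝ (TangentSpace I y)} {J : ∀ y : M, levi y →ₗ[ℝ] levi y}
  {x : M} {Ω : Set E} {P A : E → E →L[ℝ] E}

lemma symm_mem_source (h : IsLocalRep levi J x Ω P A) {p : E} (hp : p ∈ Ω) :
    (extChartAt I x).symm p ∈ (extChartAt I x).source :=
  (extChartAt I x).map_target (h.subset_target hp)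

lemma right_inv (h : IsLocalRep levi J x Ω P A) {p : E} (hp : p ∈ Ω) :
    extChartAt I x ((extChartAt I x).symm p) = p :=
  (extChartAt I x).right_inv (h.subset_target hp)

lemma proj_coordField (h : IsLocalRep levi J x Ω P A) (Z : ∀ y : M, levi y) {p : E}
    (hp : p ∈ Ω) :
    P p (coordField I x (fun y => (Z y : TangentSpace I y)) p) =
      coordField I x (fun y => (Z y : TangentSpace I y)) p := by
  have := (h.mem_iff _ (h.symm_mem_source hp) (by rwa [h.right_inv hp]) _).1
    (Z ((extChartAt I x).symm p)).2
  rwa [h.right_inv hp] at this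

lemma coordField_J (h : IsLocalRep levi J x Ω P A) (Z : ∀ y : M, levi y) {p : E}
    (hp : p ∈ Ω) :
    coordField I x (fun y => (J y (Z y) : TangentSpace I y)) p =
      A p (coordField I x (fun y => (Z y : TangentSpace I y)) p) := by
  have := h.toCoord_J _ (h.symm_mem_source hp) (by rwa [h.right_inv hp])
    (Z ((extChartAt I x).symm p))
  rwa [h.right_inv hp] at this

lemma J_J (h : IsLocalRep levi J x Ω P A) {y : M} (hy : y ∈ (extChartAt I x).source)
    (hyΩ : extChartAt I x y ∈ Ω) (z : levi y) : J y (J y z) = -z := by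
  refine Subtype.ext (toCoord_injective hy ?_)
  rw [h.toCoord_J y hy hyΩ, h.toCoord_J y hy hyΩ, h.end_end _ hyΩ, (h.mem_iff y hy hyΩ _).1 z.2,
    Submodule.coe_neg, map_neg]

lemma isOpen_domain (h : IsLocalRep levi J x Ω P A) :
    IsOpen ((extChartAt I x).source ∩ extChartAt I x ⁻¹' Ω) :=
  (continuousOn_extChartAt x).isOpen_inter_preimage (isOpen_extChartAt_source x) h.isOpen

variable [I.Boundaryless]

/-- A local section of the distribution with prescribed expression in the chart. -/
lemma exists_section (h : IsLocalRep levi J x Ω P A) {f : E → E}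
    (hf : ∀ p ∈ Ω, ContDiffAt ℝ ∞ f p) (hPf : ∀ p ∈ Ω, P p (f p) = f p) :
    ∃ Z : ∀ y : M, levi y,
      SmoothFieldOn I (fun y => (Z y : TangentSpace I y))
        ((extChartAt I x).source ∩ extChartAt I x ⁻¹' Ω) ∧
      ∀ p ∈ Ω, coordField I x (fun y => (Z y : TangentSpace I y)) p = f p := by
  classical
  have hm : ∀ y ∈ (extChartAt I x).source ∩ extChartAt I x ⁻¹' Ω,
      ofCoord I x y (f (extChartAt I x y)) ∈ levi y := fun y hy => by
    rw [h.mem_iff y hy.1 hy.2, toCoord_ofCoord hy.1]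
    exact hPf _ hy.2
  -- The value 0 outside the chart domain is harmless: smoothness is asserted only on this open set.
  let Z : ∀ y : M, levi y := fun y =>
    if hy : y ∈ (extChartAt I x).source ∩ extChartAt I x ⁻¹' Ω then
      ⟨ofCoord I x y (f (extChartAt I x y)), hm y hy⟩ else 0
  have hZ : ∀ p ∈ Ω, coordField I x (fun y => (Z y : TangentSpace I y)) p = f p := by
    intro p hp
    have hs := h.symm_mem_source hp
    have hd : (extChartAt I x).symm p ∈ (extChartAt I x).source ∩ extChartAt I x ⁻¹' Ω :=
      ⟨hs, by rwa [mem_preimage, h.right_inv hp]⟩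
    simp only [coordField, Z, dif_pos hd]
    rw [toCoord_ofCoord hs, h.right_inv hp]
  refine ⟨Z, fun y hy => ((contMDiffAt_field_iff hy.1).2 ?_).contMDiffWithinAt, hZ⟩
  exact (hf _ hy.2).congr_of_eventuallyEq (eventually_of_mem (h.isOpen.mem_nhds hy.2) hZ)

/-- The endomorphism preserves smoothness of local sections. -/
lemma smoothAt_J (h : IsLocalRep levi J x Ω P A) (hx : extChartAt I x x ∈ Ω)
    {Z : ∀ y : M, levi y} {U : Set M} (hU : IsOpen U) (hxU : x ∈ U)
    (hZ : SmoothFieldOn I (fun y => (Z y : TangentSpace I y)) U) :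
    ContMDiffAt I I.tangent ∞
      (fun y => (⟨y, (J y (Z y) : TangentSpace I y)⟩ : TangentBundle I M)) x := by
  have hs := mem_extChartAt_source (I := I) x
  rw [contMDiffAt_field_iff (X := fun y => (J y (Z y) : TangentSpace I y)) hs]
  exact ((h.smooth_end _ hx).clm_apply (hZ.contDiffAt hU hs hxU)).congr_of_eventuallyEq
    (eventually_of_mem (h.isOpen.mem_nhds hx) fun p hp => h.coordField_J Z hp)

/-- A basis of the fibre at x is extended with constant components and projected by `P`. It stays
independent on a neighbourhood because independence is an open condition, and constancy of the rank
makes it span. -/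
lemma exists_frame [FiniteDimensional ℝ E] (h : IsLocalRep levi J x Ω P A)
    (hx : extChartAt I x x ∈ Ω)
    (hr : ∀ y, Module.finrank ℝ (levi y) = Module.finrank ℝ (levi x)) :
    ∃ U : Set M, IsOpen U ∧ x ∈ U ∧
      ∃ s : Fin (Module.finrank ℝ (levi x)) → ∀ y : M, levi y,
        (∀ i, SmoothFieldOn I (fun y => (s i y : TangentSpace I y)) U) ∧
        ∀ y ∈ U, LinearIndependent ℝ (fun i => s i y) ∧
          Submodule.span ℝ (Set.range fun i => s i y) = ⊤ := by
  have hs := mem_extChartAt_source (I := I) x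
  have fd : ∀ y : M, FiniteDimensional ℝ (TangentSpace I y) := fun y =>
    inferInstanceAs (FiniteDimensional ℝ E)
  let b := Module.finBasis ℝ (levi x)
  let u : Fin (Module.finrank ℝ (levi x)) → E := fun i => toCoord I x x (b i)
  have hu : LinearIndependent ℝ u :=
    (b.linearIndependent.map' (levi x).subtype (Submodule.ker_subtype _)).map'
      (toCoord I x x : TangentSpace I x →ₗ[ℝ] E) (LinearMap.ker_eq_bot.2 (toCoord_injective hs))
  have hPu : ∀ i, P (extChartAt I x x) (u i) = u i := fun i => (h.mem_iff x hs hx _).1 (b i).2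
  have key : ∀ i, ∃ Z : ∀ y : M, levi y, SmoothFieldOn I (fun y => (Z y : TangentSpace I y))
        ((extChartAt I x).source ∩ extChartAt I x ⁻¹' Ω) ∧
      ∀ p ∈ Ω, coordField I x (fun y => (Z y : TangentSpace I y)) p = P p (u i) := fun i =>
    h.exists_section (fun p hp => (h.smooth_proj p hp).clm_apply contDiffAt_const)
      fun p hp => h.proj_proj p hp _
  choose s hsm hsc using key
  have hc : ContinuousOn (fun p i => P p (u i)) Ω := continuousOn_pi.2 fun i p hp =>
    (((h.smooth_proj p hp).continuousAt.clm_apply continuousAt_const)).continuousWithinAt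
  have hO : IsOpen (Ω ∩ (fun p i => P p (u i)) ⁻¹' {v | LinearIndependent ℝ v}) :=
    hc.isOpen_inter_preimage h.isOpen isOpen_setOfPred_linearIndependent
  refine ⟨(extChartAt I x).source ∩ extChartAt I x ⁻¹'
      (Ω ∩ (fun p i => P p (u i)) ⁻¹' {v | LinearIndependent ℝ v}),
    (continuousOn_extChartAt x).isOpen_inter_preimage (isOpen_extChartAt_source x) hO,
    ⟨hs, hx, ?_⟩, s, fun i => (hsm i).mono fun y hy => ⟨hy.1, hy.2.1⟩, fun y hy => ?_⟩
  · change LinearIndependent ℝ fun i => P (extChartAt I x x) (u i)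
    simpa only [hPu] using hu
  · have li : LinearIndependent ℝ (fun i => s i y) := by
      refine LinearIndependent.of_comp
        ((toCoord I x y : TangentSpace I y →ₗ[ℝ] E).comp (levi y).subtype) ?_
      have li' : LinearIndependent ℝ fun i => P (extChartAt I x y) (u i) := hy.2.2
      convert li' using 2 with i
      rw [← hsc i _ hy.2.1, coordField_extChartAt hy.1]
      rfl
    exact ⟨li, li.span_eq_top_of_card_eq_finrank' (by rw [Fintype.card_fin, hr y])⟩

end IsLocalRep

/-- An almost CR structure given by its local representations. -/
def AlmostCRStructure.ofLocalRep [I.Boundaryless] [FiniteDimensional ℝ E] {d : ℕ}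
    (levi : ∀ y : M, Submodule ℝ (TangentSpace I y)) (J : ∀ y : M, levi y →ₗ[ℝ] levi y)
    (codim : ∀ x : M, Module.finrank ℝ (levi x) + d = Module.finrank ℝ E)
    (rep : ∀ x : M, ∃ Ω P A, extChartAt I x x ∈ Ω ∧ IsLocalRep levi J x Ω P A) :
    AlmostCRStructure I M d where
  levi := levi
  J := J
  codim := codim
  exists_frame x := by
    obtain ⟨Ω, P, A, hx, h⟩ := rep x
    exact h.exists_frame hx fun y => by
      have := codim x
      have := codim y
      omega
  smooth_J U hU X hX x hx := by
    obtain ⟨Ω, P, A, hxΩ, h⟩ := rep x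
    exact (h.smoothAt_J hxΩ hU hx hX).contMDiffWithinAt
  J_sq x X := by
    obtain ⟨Ω, P, A, hx, h⟩ := rep x
    exact h.J_J (mem_extChartAt_source x) hx X

namespace AlmostCRStructure

variable [I.Boundaryless] {d : ℕ}

/-- Integrability is tested on sections with expressions Pu and Pw, u and w constant. Their images
under J are Au and Aw, so every bracket reduces to an `endBracket`. -/
lemma isIntegrableProjector [CompleteSpace E] {C : AlmostCRStructure I M d} (hC : C.IsIntegrable)
    {x : M} {Ω : Set E} {P A : E → E →L[ℝ] E} (h : IsLocalRep C.levi C.J x Ω P A) :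
    IsIntegrableProjector Ω P A := by
  intro p hp u w
  have sec : ∀ u : E, _ := fun u => h.exists_section (f := fun p => P p u)
    (fun p hp => (h.smooth_proj p hp).clm_apply contDiffAt_const) fun p hp => h.proj_proj p hp u
  obtain ⟨X, hX, hXc⟩ := sec u
  obtain ⟨Y, hY, hYc⟩ := sec w
  have hys := h.symm_mem_source hp
  have hyp := h.right_inv hp
  set y := (extChartAt I x).symm p
  set U := (extChartAt I x).source ∩ extChartAt I x ⁻¹' Ω
  have hU : IsOpen U := h.isOpen_domain
  have hyU : y ∈ U := ⟨hys, by rwa [mem_preimage, hyp]⟩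
  have sm : ∀ {Z : ∀ y : M, C.levi y}, SmoothFieldOn I (fun y => (Z y : TangentSpace I y)) U →
      ContMDiffAt I I.tangent ∞
        (fun y => (⟨y, (Z y : TangentSpace I y)⟩ : TangentBundle I M)) y :=
    fun hZ => (hZ y hyU).contMDiffAt (hU.mem_nhds hyU)
  have hJX := C.smooth_J U hU X hX
  have hJY := C.smooth_J U hU Y hY
  have ev : ∀ {Z : ∀ y : M, C.levi y} {u : E},
      (∀ p ∈ Ω, coordField I x (fun y => (Z y : TangentSpace I y)) p = P p u) →
      (coordField I x (fun y => (Z y : TangentSpace I y)) =ᶠ[𝓝 p] fun p => P p u) ∧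
      (coordField I x (fun y => (C.J y (Z y) : TangentSpace I y)) =ᶠ[𝓝 p] fun p => A p u) :=
    fun {Z u} hZ => ⟨eventually_of_mem (h.isOpen.mem_nhds hp) hZ,
      eventually_of_mem (h.isOpen.mem_nhds hp) fun p hp => by
        rw [h.coordField_J Z hp, hZ p hp, h.end_proj p hp]⟩
  have dP := h.differentiableAt_proj hp
  have dA := h.differentiableAt_end hp
  obtain ⟨eX, eJX⟩ := ev hXc
  obtain ⟨eY, eJY⟩ := ev hYc
  have b1 := toCoord_mlieBracket hys (sm hJX) (sm hY)
  have b2 := toCoord_mlieBracket hys (sm hX) (sm hJY)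
  have b3 := toCoord_mlieBracket hys (sm hJX) (sm hJY)
  have b4 := toCoord_mlieBracket hys (sm hX) (sm hY)
  rw [hyp] at b1 b2 b3 b4
  rw [eJX.lieBracket_vectorField_eq eY, IsComplexProjector.lieBracket_clm_apply_const dA dP] at b1
  rw [eX.lieBracket_vectorField_eq eJY, IsComplexProjector.lieBracket_clm_apply_const dP dA] at b2
  rw [eJX.lieBracket_vectorField_eq eJY, IsComplexProjector.lieBracket_clm_apply_const dA dA] at b3
  rw [eX.lieBracket_vectorField_eq eY, IsComplexProjector.lieBracket_clm_apply_const dP dP] at b4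
  obtain ⟨hm, he⟩ := hC U hU X Y hX hY y hyU
  have h1 := (h.mem_iff y hys hyU.2 _).1 hm
  have h2 := h.toCoord_J y hys hyU.2 ⟨_, hm⟩
  rw [map_add, b1, b2, hyp] at h1
  have h3 := congrArg (toCoord I x y) he
  rw [map_sub, map_sub, map_zero, b3, b4, h2, hyp, map_add, b1, b2] at h3
  exact ⟨h1, h3⟩

lemma isIntegrable_of_localRep [CompleteSpace E] (C : AlmostCRStructure I M d)
    (rep : ∀ x : M, ∃ Ω P A, extChartAt I x x ∈ Ω ∧ IsLocalRep C.levi C.J x Ω P A ∧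
      IsIntegrableProjector Ω P A) : C.IsIntegrable := by
  intro U hU X Y hX hY x hxU
  obtain ⟨Ω, P, A, hx, h, hi⟩ := rep x
  have hs := mem_extChartAt_source (I := I) x
  have sm : ∀ {Z : ∀ y : M, C.levi y}, SmoothFieldOn I (fun y => (Z y : TangentSpace I y)) U →
      ContMDiffAt I I.tangent ∞
        (fun y => (⟨y, (Z y : TangentSpace I y)⟩ : TangentBundle I M)) x :=
    fun hZ => (hZ x hxU).contMDiffAt (hU.mem_nhds hxU)
  have hJX := C.smooth_J U hU X hX
  have hJY := C.smooth_J U hU Y hY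
  have ev : ∀ Z : ∀ y : M, C.levi y,
      coordField I x (fun y => (C.J y (Z y) : TangentSpace I y)) =ᶠ[𝓝 (extChartAt I x x)]
        fun p => A p (coordField I x (fun y => (Z y : TangentSpace I y)) p) :=
    fun Z => eventually_of_mem (h.isOpen.mem_nhds hx) fun p hp => h.coordField_J Z hp
  have r : ∀ Z : E → E, Z =ᶠ[𝓝 (extChartAt I x x)] Z := fun Z => EventuallyEq.refl _ _
  have b1 := toCoord_mlieBracket hs (sm hJX) (sm hY)
  have b2 := toCoord_mlieBracket hs (sm hX) (sm hJY)
  have b3 := toCoord_mlieBracket hs (sm hJX) (sm hJY)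
  have b4 := toCoord_mlieBracket hs (sm hX) (sm hY)
  rw [(ev X).lieBracket_vectorField_eq (r _)] at b1
  rw [(r _).lieBracket_vectorField_eq (ev Y)] at b2
  rw [(ev X).lieBracket_vectorField_eq (ev Y)] at b3
  obtain ⟨i1, i2⟩ := h.integrable_of_isIntegrableProjector hi hx
    ((hX.contDiffAt hU hs hxU).differentiableAt (by simp))
    ((hY.contDiffAt hU hs hxU).differentiableAt (by simp))
    (eventually_of_mem (h.isOpen.mem_nhds hx) fun p hp => h.proj_coordField X hp)
    (eventually_of_mem (h.isOpen.mem_nhds hx) fun p hp => h.proj_coordField Y hp)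
  rw [← b1, ← b2, ← map_add] at i1 i2
  have hm := (h.mem_iff x hs hx _).2 i1
  refine ⟨hm, toCoord_injective hs ?_⟩
  rw [map_sub, map_sub, map_zero, h.toCoord_J x hs hx ⟨_, hm⟩, b3, b4]
  exact i2

end AlmostCRStructure

end LocalRepresentation

/-! ### From smooth local frames to complex projectors. -/

section FrameRepresentation

/-- Smooth coordinate functionals for a smooth frame, near a point. -/
lemma exists_contDiffAt_dual_frame {E : Type*} [NormedAddCommGroup E] [NormedSpace ℝ E]
    [FiniteDimensional ℝ E] {k : ℕ} {V : Set E} (hV : IsOpen V) {p₀ : E} (hp₀ : p₀ ∈ V)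
    {f : Fin k → E → E} (hf : ∀ i, ∀ p ∈ V, ContDiffAt ℝ ∞ (f i) p)
    (hli : LinearIndependent ℝ fun i => f i p₀) :
    ∃ (Ω : Set E) (R : E → E →L[ℝ] (Fin k → ℝ)), IsOpen Ω ∧ p₀ ∈ Ω ∧ Ω ⊆ V ∧
      (∀ p ∈ Ω, ContDiffAt ℝ ∞ R p) ∧ ∀ p ∈ Ω, ∀ c : Fin k → ℝ, R p (∑ i, c i • f i p) = c := by
  let S : E → (Fin k → ℝ) →L[ℝ] E := fun p =>
    ∑ i, (ContinuousLinearMap.proj (R := ℝ) (φ := fun _ : Fin k => ℝ) i).smulRight (f i p)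
  have hS : ∀ p c, S p c = ∑ i, c i • f i p := fun p c => by simp [S]
  have hSs : ∀ p ∈ V, ContDiffAt ℝ ∞ S p := fun p hp => ContDiffAt.sum fun i _ =>
    ((ContinuousLinearMap.smulRightL ℝ (Fin k → ℝ) E
      (ContinuousLinearMap.proj i)).contDiff.contDiffAt.comp p (hf i p hp))
  have hinj : LinearMap.ker (S p₀ : (Fin k → ℝ) →ₗ[ℝ] E) = ⊥ := by
    rw [LinearMap.ker_eq_bot']
    intro c hc
    funext i
    exact Fintype.linearIndependent_iff.1 hli c ((hS p₀ c).symm.trans hc) i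
  -- A left inverse L of the frame map S at `p₀` makes L∘S(p) equal to the identity at `p₀`, hence
  -- invertible nearby; (L∘S(p))⁻¹∘L is then a left inverse of S(p) that is smooth in p.
  obtain ⟨L, hL⟩ := LinearMap.exists_leftInverse_of_injective _ hinj
  let G : E → (Fin k → ℝ) →L[ℝ] (Fin k → ℝ) := fun p =>
    (LinearMap.toContinuousLinearMap L).comp (S p)
  have hG : ∀ p ∈ V, ContDiffAt ℝ ∞ G p := fun p hp => contDiffAt_const.clm_comp (hSs p hp)
  have hG₀ : G p₀ = 1 := by
    ext1 c
    exact congrArg (fun T : (Fin k → ℝ) →ₗ[ℝ] (Fin k → ℝ) => T c) hL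
  refine ⟨V ∩ G ⁻¹' {T | IsUnit T}, fun p => (Ring.inverse (G p)).comp L.toContinuousLinearMap,
    ContinuousOn.isOpen_inter_preimage (fun p hp => (hG p hp).continuousAt.continuousWithinAt) hV
      Units.isOpen, ⟨hp₀, ?_⟩, inter_subset_left, fun p hp => ?_, fun p hp c => ?_⟩
  · change IsUnit (G p₀)
    rw [hG₀]
    exact isUnit_one
  · obtain ⟨a, ha⟩ : IsUnit (G p) := hp.2
    have h1 : ContDiffAt ℝ ∞ Ring.inverse (G p) := by
      rw [← ha]; exact contDiffAt_ringInverse ℝ a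
    exact (h1.comp p (hG p hp.1)).clm_comp contDiffAt_const
  · have hu : IsUnit (G p) := hp.2
    rw [← hS]
    exact congrArg (fun T : (Fin k → ℝ) →L[ℝ] (Fin k → ℝ) => T c) (Ring.inverse_mul_cancel _ hu)

variable {E : Type*} [NormedAddCommGroup E] [NormedSpace ℝ E]
  {H : Type*} [TopologicalSpace H] {I : ModelWithCorners ℝ E H}
  {M : Type*} [TopologicalSpace M] [ChartedSpace H M] [IsManifold I ∞ M]

lemma contDiffAt_sum_smulRight {k : ℕ} {R : E → E →L[ℝ] (Fin k → ℝ)} {f : Fin k → E → E} {p : E}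
    (hR : ContDiffAt ℝ ∞ R p) (hf : ∀ i, ContDiffAt ℝ ∞ (f i) p) :
    ContDiffAt ℝ ∞ (fun p => ∑ i,
      ((ContinuousLinearMap.proj (R := ℝ) (φ := fun _ : Fin k => ℝ) i).comp (R p)).smulRight
        (f i p)) p :=
  ContDiffAt.sum fun i _ => (contDiffAt_const.clm_comp hR).smulRight (hf i)

/-- An almost CR structure has local representations. -/
lemma AlmostCRStructure.exists_localRep [I.Boundaryless] [FiniteDimensional ℝ E] {d : ℕ}
    (C : AlmostCRStructure I M d) (x : M) :
    ∃ Ω P A, extChartAt I x x ∈ Ω ∧ IsLocalRep C.levi C.J x Ω P A := by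
  obtain ⟨U, hU, hxU, s, hs, hfr⟩ := C.exists_frame x
  have hxs := mem_extChartAt_source (I := I) x
  have hsJ := fun i => C.smooth_J U hU (s i) (hs i)
  let V : Set E := (extChartAt I x).target ∩ (extChartAt I x).symm ⁻¹' U
  have hV : IsOpen V := (continuousOn_extChartAt_symm x).isOpen_inter_preimage
    (isOpen_extChartAt_target x) hU
  have hxV : extChartAt I x x ∈ V :=
    ⟨mem_extChartAt_target x, by rwa [mem_preimage, extChartAt_to_inv]⟩
  let f : Fin (Module.finrank ℝ (C.levi x)) → E → E := fun i =>
    coordField I x fun y => (s i y : TangentSpace I y)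
  let g : Fin (Module.finrank ℝ (C.levi x)) → E → E := fun i =>
    coordField I x fun y => (C.J y (s i y) : TangentSpace I y)
  have sm : ∀ {X : ∀ y : M, TangentSpace I y}, SmoothFieldOn I X U → ∀ p ∈ V,
      ContDiffAt ℝ ∞ (coordField I x X) p := fun hX p hp => by
    have := hX.contDiffAt hU ((extChartAt I x).map_target hp.1) hp.2
    rwa [(extChartAt I x).right_inv hp.1] at this
  have hf : ∀ i, ∀ p ∈ V, ContDiffAt ℝ ∞ (f i) p := fun i => sm (hs i)
  have hg : ∀ i, ∀ p ∈ V, ContDiffAt ℝ ∞ (g i) p := fun i => sm (hsJ i)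
  have hfy : ∀ i, ∀ y ∈ (extChartAt I x).source,
      f i (extChartAt I x y) = toCoord I x y (s i y) := fun i y hy => coordField_extChartAt hy _
  have hgy : ∀ i, ∀ y ∈ (extChartAt I x).source,
      g i (extChartAt I x y) = toCoord I x y (C.J y (s i y)) :=
    fun i y hy => coordField_extChartAt hy _
  have hli : LinearIndependent ℝ fun i => f i (extChartAt I x x) := by
    simp only [hfy _ x hxs]
    exact ((hfr x hxU).1.map' (C.levi x).subtype (Submodule.ker_subtype _)).map'
      (toCoord I x x : TangentSpace I x →ₗ[ℝ] E) (LinearMap.ker_eq_bot.2 (toCoord_injective hxs))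
  obtain ⟨Ω, R, hΩ, hxΩ, hΩV, hR, hRc⟩ := exists_contDiffAt_dual_frame hV hxV hf hli
  -- `R` reads off frame coefficients. `P` recombines them with the frame and `A` with its image
  -- under J, so `A` is J extended by zero on the kernel of `P`.
  let P : E → E →L[ℝ] E := fun p => ∑ i,
    ((ContinuousLinearMap.proj (R := ℝ) (φ := fun _ => ℝ) i).comp (R p)).smulRight (f i p)
  let A : E → E →L[ℝ] E := fun p => ∑ i,
    ((ContinuousLinearMap.proj (R := ℝ) (φ := fun _ => ℝ) i).comp (R p)).smulRight (g i p)
  have hP : ∀ p u, P p u = ∑ i, R p u i • f i p := fun p u => by simp [P]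
  have hA : ∀ p u, A p u = ∑ i, R p u i • g i p := fun p u => by simp [A]
  have hRP : ∀ p ∈ Ω, ∀ u, R p (P p u) = R p u := fun p hp u => by rw [hP, hRc p hp]
  have toP : ∀ y ∈ (extChartAt I x).source, ∀ c : Fin _ → ℝ,
      ∑ i, c i • f i (extChartAt I x y) = toCoord I x y (∑ i, c i • s i y : C.levi y) ∧
      ∑ i, c i • g i (extChartAt I x y) =
        toCoord I x y (C.J y (∑ i, c i • s i y : C.levi y)) := fun y hy c => by
    simp only [hfy _ y hy, hgy _ y hy]
    simp
  have hyU : ∀ y ∈ (extChartAt I x).source, extChartAt I x y ∈ Ω → y ∈ U := fun y hy hyΩ => by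
    have := (hΩV hyΩ).2
    rwa [mem_preimage, (extChartAt I x).left_inv hy] at this
  have span : ∀ y ∈ (extChartAt I x).source, extChartAt I x y ∈ Ω → ∀ z : C.levi y,
      ∃ c : Fin _ → ℝ, ∑ i, c i • s i y = z := fun y hy hyΩ z => by
    have : z ∈ Submodule.span ℝ (Set.range fun i => s i y) := by
      rw [(hfr y (hyU y hy hyΩ)).2]; trivial
    exact (Submodule.mem_span_range_iff_exists_fun ℝ).1 this
  have mem : ∀ y ∈ (extChartAt I x).source, extChartAt I x y ∈ Ω → ∀ z : C.levi y,
      P (extChartAt I x y) (toCoord I x y z) = toCoord I x y z ∧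
      A (extChartAt I x y) (toCoord I x y z) = toCoord I x y (C.J y z) := fun y hy hyΩ z => by
    obtain ⟨c, rfl⟩ := span y hy hyΩ z
    rw [← (toP y hy c).1, ← (toP y hy c).2, hP, hA, hRc _ hyΩ]
    exact ⟨rfl, rfl⟩
  have pt : ∀ p ∈ Ω, ∃ y ∈ (extChartAt I x).source, extChartAt I x y = p := fun p hp =>
    ⟨_, (extChartAt I x).map_target (hΩV hp).1, (extChartAt I x).right_inv (hΩV hp).1⟩
  refine ⟨Ω, P, A, hxΩ, ?_⟩
  constructor
  · constructor
    · exact hΩ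
    · exact fun p hp => contDiffAt_sum_smulRight (hR p hp) fun i => hf i p (hΩV hp)
    · exact fun p hp => contDiffAt_sum_smulRight (hR p hp) fun i => hg i p (hΩV hp)
    · intro p hp u
      rw [hP p (P p u), hRP p hp, hP]
    · intro p hp u
      obtain ⟨y, hy, rfl⟩ := pt p hp
      rw [hA, (toP y hy _).2, (mem y hy hp _).1]
    · intro p hp u
      rw [hA p (P p u), hRP p hp, hA]
    · intro p hp u
      obtain ⟨y, hy, rfl⟩ := pt p hp
      rw [hA _ u, (toP y hy _).2, (mem y hy hp _).2, hP, (toP y hy _).1, C.J_sq]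
      simp
  · exact hΩV.trans inter_subset_left
  · intro y hy hyΩ z
    refine ⟨fun hz => (mem y hy hyΩ ⟨z, hz⟩).1, fun hz => ?_⟩
    rw [hP, (toP y hy _).1] at hz
    rw [← toCoord_injective hy hz]
    exact Subtype.property _
  · exact fun y hy hyΩ z => (mem y hy hyΩ z).2.symm

end FrameRepresentation

/-! ### The lifted CR structure on the tangent bundle. -/

section CompleteLift

variable {E : Type*} [NormedAddCommGroup E] [NormedSpace ℝ E]
  {H : Type*} [TopologicalSpace H] {I : ModelWithCorners ℝ E H}
  {M : Type*} [TopologicalSpace M] [ChartedSpace H M] [IsManifold I ∞ M]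

/-- The expression of a `(1,1)`-tensor field in the preferred chart at `x`. -/
def coordTensor (A : ∀ y : M, TangentSpace I y →L[ℝ] TangentSpace I y) (x : M) (p : E) :
    E →L[ℝ] E :=
  tensorComponents A x ((extChartAt I x).symm p)

lemma tensorComponents_eq (A : ∀ y : M, TangentSpace I y →L[ℝ] TangentSpace I y) {x y : M}
    (hy : y ∈ (extChartAt I x).source) :
    tensorComponents A x y = (toCoord I x y).comp ((A y).comp (ofCoord I x y)) := by
  rw [extChartAt_source] at hy
  exact inTangentCoordinates_eq (I := I) (I' := I) id id (fun y => (A y : E →L[ℝ] E)) (x₀ := x)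
    hy hy

lemma coordTensor_coordField (A : ∀ y : M, TangentSpace I y →L[ℝ] TangentSpace I y) {x : M}
    {p : E} (hp : p ∈ (extChartAt I x).target) (Z : ∀ y : M, TangentSpace I y) :
    coordTensor A x p (coordField I x Z p) = coordField I x (fun y => A y (Z y)) p := by
  have hs := (extChartAt I x).map_target hp
  rw [coordTensor, tensorComponents_eq A hs, coordField, coordField]
  simp only [ContinuousLinearMap.comp_apply, ofCoord_toCoord hs]

lemma coordTensor_self (A : ∀ y : M, TangentSpace I y →L[ℝ] TangentSpace I y) (x : M)
    (z : TangentSpace I x) : coordTensor A x (extChartAt I x x) z = A x z := by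
  have hs := mem_extChartAt_source (I := I) x
  have h := ofCoord_toCoord hs z
  rw [toCoord_self] at h
  rw [coordTensor, extChartAt_to_inv, tensorComponents_eq A hs]
  refine (toCoord_self x _).trans ?_
  exact congrArg (A x) h

lemma SmoothTensorOn.contMDiffAt {A : ∀ y : M, TangentSpace I y →L[ℝ] TangentSpace I y}
    {U : Set M} (h : SmoothTensorOn I A U) (hU : IsOpen U) {x : M} (hx : x ∈ U) :
    ContMDiffAt I 𝓘(ℝ, E →L[ℝ] E) ∞ (tensorComponents A x) x :=
  (Bundle.contMDiffAt_section x).1 ((h x hx).contMDiffAt (hU.mem_nhds hx))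

section Projection

variable [I.Boundaryless]

lemma mfderiv_tangentBundle_proj (v : TangentBundle I M) (z : TangentSpace I.tangent v) :
    mfderiv I.tangent I (fun v : TangentBundle I M => v.proj) v z = (z : E × E).1 := by
  have hm : ContMDiffAt I.tangent I ∞ (fun v : TangentBundle I M => v.proj) v :=
    Bundle.contMDiffAt_proj (TangentSpace I)
  have e := (hm.mdifferentiableAt (by simp)).mfderiv
  rw [I.tangent.range_eq_univ, fderivWithin_univ, extChartAt_tangent_self] at e
  have ev : writtenInExtChartAt I.tangent I v (fun v : TangentBundle I M => v.proj)
      =ᶠ[𝓝 ((extChartAt I v.proj v.proj, v.snd) : E × E)] fun q : E × E => q.1 := by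
    have hn : ∀ᶠ q : E × E in 𝓝 ((extChartAt I v.proj v.proj, v.snd) : E × E),
        q.1 ∈ (extChartAt I v.proj).target :=
      continuousAt_fst.eventually_mem
        ((isOpen_extChartAt_target v.proj).mem_nhds (mem_extChartAt_target v.proj))
    filter_upwards [hn] with q hq
    exact (extChartAt I v.proj).right_inv hq
  have hf : fderiv ℝ (fun q : E × E => q.1) (extChartAt I v.proj v.proj, v.snd) =
    ContinuousLinearMap.fst ℝ E E := fderiv_fst
  exact congrArg (fun T : E × E →L[ℝ] E => T z) (e.trans (ev.fderiv_eq.trans hf))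

lemma completeLiftTensor_eq_endLift {A : ∀ y : M, TangentSpace I y →L[ℝ] TangentSpace I y}
    {v : TangentBundle I M}
    (hA : ContMDiffAt I 𝓘(ℝ, E →L[ℝ] E) ∞ (tensorComponents A v.proj) v.proj)
    (z : TangentSpace I.tangent v) : completeLiftTensor A v z =
      endLift (coordTensor A v.proj) (extChartAt I v.proj v.proj, v.snd) z := by
  have e := (hA.mdifferentiableAt (by simp)).mfderiv
  rw [I.range_eq_univ, fderivWithin_univ] at e
  have e' : mfderiv I 𝓘(ℝ, E →L[ℝ] E) (tensorComponents A v.proj) v.proj v.snd =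
      fderiv ℝ (coordTensor A v.proj) (extChartAt I v.proj v.proj) v.snd :=
    congrArg (fun T : E →L[ℝ] E →L[ℝ] E => T v.snd) e
  refine Prod.ext ?_ ?_
  · exact (coordTensor_self A v.proj _).symm
  · exact congrArg₂ (fun a b : E => a + b)
      (congrArg (fun T : E →L[ℝ] E => T (z : E × E).1) e') (coordTensor_self A v.proj _).symm

end Projection

namespace AlmostCRStructure

variable {d : ℕ} (C : AlmostCRStructure I M d)

lemma verticalLift_mem_liftedLevi {v : TangentBundle I M} {U : Set M} (hU : IsOpen U)
    (hv : v.proj ∈ U) {Z : ∀ y : M, C.levi y}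
    (hZ : SmoothFieldOn I (fun y => (Z y : TangentSpace I y)) U) :
    verticalLift v (Z v.proj : TangentSpace I v.proj) ∈ C.liftedLevi v :=
  Submodule.subset_span ⟨U, Z, hU, hv, hZ, Or.inl rfl⟩

lemma completeLift_mem_liftedLevi {v : TangentBundle I M} {U : Set M} (hU : IsOpen U)
    (hv : v.proj ∈ U) {Z : ∀ y : M, C.levi y}
    (hZ : SmoothFieldOn I (fun y => (Z y : TangentSpace I y)) U) :
    completeLift (fun y => (Z y : TangentSpace I y)) v ∈ C.liftedLevi v :=
  Submodule.subset_span ⟨U, Z, hU, hv, hZ, Or.inr rfl⟩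

/-- Linear maps agree on the lifted distribution as soon as they agree on lifts of sections. -/
lemma eqOn_liftedLevi {V : Type*} [AddCommGroup V] [Module ℝ V] {v : TangentBundle I M}
    {S T : TangentSpace I.tangent v →ₗ[ℝ] V}
    (h : ∀ (U : Set M) (Z : ∀ y : M, C.levi y), IsOpen U → v.proj ∈ U →
      SmoothFieldOn I (fun y => (Z y : TangentSpace I y)) U →
      S (verticalLift v (Z v.proj : TangentSpace I v.proj)) =
          T (verticalLift v (Z v.proj : TangentSpace I v.proj)) ∧
        S (completeLift (fun y => (Z y : TangentSpace I y)) v) =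
          T (completeLift (fun y => (Z y : TangentSpace I y)) v))
    {z : TangentSpace I.tangent v} (hz : z ∈ C.liftedLevi v) : S z = T z := by
  refine LinearMap.eqOn_span (f := S) (g := T) ?_ hz
  rintro _ ⟨U, Z, hU, hv, hZ, rfl | rfl⟩
  exacts [(h U Z hU hv hZ).1, (h U Z hU hv hZ).2]

end AlmostCRStructure

namespace IsLocalRep

lemma mem_iff_self {levi : ∀ y : M, Submodule ℝ (TangentSpace I y)}
    {J : ∀ y : M, levi y →ₗ[ℝ] levi y} {x : M} {Ω : Set E} {P A : E → E →L[ℝ] E}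
    (h : IsLocalRep levi J x Ω P A) (hx : extChartAt I x x ∈ Ω) (z : TangentSpace I x) :
    z ∈ levi x ↔ P (extChartAt I x x) z = z := by
  have := h.mem_iff x (mem_extChartAt_source x) hx z
  rwa [toCoord_self] at this

lemma J_eq_self {levi : ∀ y : M, Submodule ℝ (TangentSpace I y)}
    {J : ∀ y : M, levi y →ₗ[ℝ] levi y} {x : M} {Ω : Set E} {P A : E → E →L[ℝ] E}
    (h : IsLocalRep levi J x Ω P A) (hx : extChartAt I x x ∈ Ω) (z : levi x) :
    (J x z : TangentSpace I x) = A (extChartAt I x x) (z : TangentSpace I x) := by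
  have := h.toCoord_J x (mem_extChartAt_source x) hx z
  rwa [toCoord_self, toCoord_self] at this

variable [I.Boundaryless] {d : ℕ} {C : AlmostCRStructure I M d} {v w : TangentBundle I M}
  {Ω : Set E} {P A : E → E →L[ℝ] E}

/-- For vertical lifts only F Z = Z' at the point matters; for complete lifts the relation is
differentiated by the product rule. It is applied with F = P and Z' = Z, and with Z' = JZ for F
either `A` or an arbitrary smooth extension of J. -/
lemma _root_.AlmostCRStructure.toCoord_lift (hv : v.proj ∈ (extChartAt I w.proj).source)
    {U : Set M} (hU : IsOpen U) (hvU : v.proj ∈ U) {Z : ∀ y : M, C.levi y}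
    (hZ : SmoothFieldOn I (fun y => (Z y : TangentSpace I y)) U)
    {F : E → E →L[ℝ] E} (hF : DifferentiableAt ℝ F (extChartAt I w.proj v.proj))
    {Z' : ∀ y : M, C.levi y} (hZ' : SmoothFieldOn I (fun y => (Z' y : TangentSpace I y)) U)
    (hFZ : ∀ᶠ p in 𝓝 (extChartAt I w.proj v.proj),
      F p (coordField I w.proj (fun y => (Z y : TangentSpace I y)) p) =
        coordField I w.proj (fun y => (Z' y : TangentSpace I y)) p) :
    endLift F (extChartAt I.tangent w v)
        (toCoord I.tangent w v (verticalLift v (Z v.proj : TangentSpace I v.proj))) =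
      toCoord I.tangent w v (verticalLift v (Z' v.proj : TangentSpace I v.proj)) ∧
    endLift F (extChartAt I.tangent w v)
        (toCoord I.tangent w v (completeLift (fun y => (Z y : TangentSpace I y)) v)) =
      toCoord I.tangent w v (completeLift (fun y => (Z' y : TangentSpace I y)) v) := by
  have cd : ∀ {Z : ∀ y : M, C.levi y}, SmoothFieldOn I (fun y => (Z y : TangentSpace I y)) U →
      ContMDiffAt I I.tangent ∞
        (fun y => (⟨y, (Z y : TangentSpace I y)⟩ : TangentBundle I M)) v.proj :=
    fun hZ => (hZ _ hvU).contMDiffAt (hU.mem_nhds hvU)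
  constructor
  · rw [toCoord_verticalLift hv, toCoord_verticalLift hv, endLift_apply]
    have := hFZ.self_of_nhds
    rw [coordField_extChartAt hv, coordField_extChartAt hv] at this
    refine Prod.ext (map_zero _) ?_
    simp only [map_zero, zero_add]
    exact this
  · rw [toCoord_completeLift hv (cd hZ), toCoord_completeLift hv (cd hZ'),
      ← tangentLift_clm_apply hF ((hZ.contDiffAt hU hv hvU).differentiableAt (by simp))]
    exact Filter.EventuallyEq.tangentLift_eq hFZ

lemma toCoord_lift_proj (h : IsLocalRep C.levi C.J w.proj Ω P A)
    (hv : v.proj ∈ (extChartAt I w.proj).source) (hvΩ : extChartAt I w.proj v.proj ∈ Ω)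
    {U : Set M} (hU : IsOpen U) (hvU : v.proj ∈ U) {Z : ∀ y : M, C.levi y}
    (hZ : SmoothFieldOn I (fun y => (Z y : TangentSpace I y)) U) :
    endLift P (extChartAt I.tangent w v)
        (toCoord I.tangent w v (verticalLift v (Z v.proj : TangentSpace I v.proj))) =
      toCoord I.tangent w v (verticalLift v (Z v.proj : TangentSpace I v.proj)) ∧
    endLift P (extChartAt I.tangent w v)
        (toCoord I.tangent w v (completeLift (fun y => (Z y : TangentSpace I y)) v)) =
      toCoord I.tangent w v (completeLift (fun y => (Z y : TangentSpace I y)) v) :=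
  AlmostCRStructure.toCoord_lift hv hU hvU hZ (h.differentiableAt_proj hvΩ) hZ
    (eventually_of_mem (h.isOpen.mem_nhds hvΩ) fun _ hp => h.proj_coordField Z hp)

lemma toCoord_lift_J (h : IsLocalRep C.levi C.J w.proj Ω P A)
    (hv : v.proj ∈ (extChartAt I w.proj).source) (hvΩ : extChartAt I w.proj v.proj ∈ Ω)
    {U : Set M} (hU : IsOpen U) (hvU : v.proj ∈ U) {Z : ∀ y : M, C.levi y}
    (hZ : SmoothFieldOn I (fun y => (Z y : TangentSpace I y)) U) :
    endLift A (extChartAt I.tangent w v)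
        (toCoord I.tangent w v (verticalLift v (Z v.proj : TangentSpace I v.proj))) =
      toCoord I.tangent w v (verticalLift v (C.J v.proj (Z v.proj) : TangentSpace I v.proj)) ∧
    endLift A (extChartAt I.tangent w v)
        (toCoord I.tangent w v (completeLift (fun y => (Z y : TangentSpace I y)) v)) =
      toCoord I.tangent w v (completeLift (fun y => (C.J y (Z y) : TangentSpace I y)) v) :=
  AlmostCRStructure.toCoord_lift hv hU hvU hZ (h.differentiableAt_end hvΩ) (C.smooth_J U hU Z hZ)
    (eventually_of_mem (h.isOpen.mem_nhds hvΩ) fun _ hp => (h.coordField_J Z hp).symm)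

/-- Lifts of sections are fixed by the lifted projector, hence so is their span. Conversely, a fixed
vector with components (a, b) is the complete lift of the section Pa plus the vertical lift of the
section Pb, with a and b held constant. -/
lemma mem_liftedLevi_iff (h : IsLocalRep C.levi C.J w.proj Ω P A)
    (hv : v.proj ∈ (extChartAt I w.proj).source) (hvΩ : extChartAt I w.proj v.proj ∈ Ω)
    (z : TangentSpace I.tangent v) : z ∈ C.liftedLevi v ↔
      endLift P (extChartAt I.tangent w v) (toCoord I.tangent w v z) =
        toCoord I.tangent w v z := by
  have hw : v ∈ (extChartAt I.tangent w).source := mem_extChartAt_tangent_source.2 hv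
  constructor
  · intro hz
    exact C.eqOn_liftedLevi
      (S := ((endLift P (extChartAt I.tangent w v)).comp (toCoord I.tangent w v)).toLinearMap)
      (T := (toCoord I.tangent w v).toLinearMap)
      (fun U Z hU hvU hZ => h.toCoord_lift_proj hv hvΩ hU hvU hZ) hz
  · intro hz
    have sec : ∀ u : E, _ := fun u => h.exists_section (f := fun p => P p u)
      (fun p hp => (h.smooth_proj p hp).clm_apply contDiffAt_const) fun p hp => h.proj_proj p hp u
    set t := toCoord I.tangent w v z with ht
    obtain ⟨X, hX, hXc⟩ := sec t.1
    obtain ⟨Y, hY, hYc⟩ := sec t.2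
    have hd : v.proj ∈ (extChartAt I w.proj).source ∩ extChartAt I w.proj ⁻¹' Ω := ⟨hv, hvΩ⟩
    have cX := (hX _ hd).contMDiffAt (h.isOpen_domain.mem_nhds hd)
    have e1 := toCoord_completeLift hv cX
    have e2 := toCoord_verticalLift hv (Y v.proj : TangentSpace I v.proj)
    rw [← coordField_extChartAt hv (fun y => (Y y : TangentSpace I y)), hYc _ hvΩ] at e2
    rw [Filter.EventuallyEq.tangentLift_eq (eventually_of_mem (h.isOpen.mem_nhds hvΩ) hXc)] at e1
    have key : z = completeLift (fun y => (X y : TangentSpace I y)) v +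
        verticalLift v (Y v.proj : TangentSpace I v.proj) := by
      refine toCoord_injective hw ?_
      rw [map_add, e1, e2, ← ht]
      refine hz.symm.trans ?_
      rw [endLift_apply, tangentLift, extChartAt_tangent_apply,
        fderiv_clm_apply (h.differentiableAt_proj hvΩ) (differentiableAt_const _)]
      simp
    rw [key]
    exact add_mem (C.completeLift_mem_liftedLevi h.isOpen_domain hd hX)
      (C.verticalLift_mem_liftedLevi h.isOpen_domain hd hY)

lemma mem_liftedLevi_iff_self (h : IsLocalRep C.levi C.J v.proj Ω P A)
    (hvΩ : extChartAt I v.proj v.proj ∈ Ω) (z : TangentSpace I.tangent v) :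
    z ∈ C.liftedLevi v ↔ endLift P (extChartAt I v.proj v.proj, v.snd) z = z := by
  have := h.mem_liftedLevi_iff (v := v) (w := v) (mem_extChartAt_source v.proj) hvΩ z
  rwa [toCoord_self, extChartAt_tangent_self] at this

end IsLocalRep

namespace AlmostCRStructure

variable [I.Boundaryless] [FiniteDimensional ℝ E] {d : ℕ} (C : AlmostCRStructure I M d)

/-- A local extension of the structure endomorphism, in the preferred chart at `x`. -/
def localEnd (x : M) : E → E →L[ℝ] E := (C.exists_localRep x).choose_spec.choose_spec.choose

lemma localEnd_spec (x : M) :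
    ∃ Ω P, extChartAt I x x ∈ Ω ∧ IsLocalRep C.levi C.J x Ω P (C.localEnd x) :=
  ⟨_, _, (C.exists_localRep x).choose_spec.choose_spec.choose_spec⟩

/-- The complete lift of the local extension of the structure endomorphism. -/
def ambientLiftedJ (v : TangentBundle I M) :
    TangentSpace I.tangent v →ₗ[ℝ] TangentSpace I.tangent v :=
  let f : E × E →L[ℝ] E × E :=
    endLift (C.localEnd v.proj) (extChartAt I v.proj v.proj, v.snd)
  f.toLinearMap

variable {C} in
lemma ambientLiftedJ_lift {v : TangentBundle I M} {U : Set M} (hU : IsOpen U) (hvU : v.proj ∈ U)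
    {Z : ∀ y : M, C.levi y} (hZ : SmoothFieldOn I (fun y => (Z y : TangentSpace I y)) U) :
    C.ambientLiftedJ v (verticalLift v (Z v.proj : TangentSpace I v.proj)) =
        verticalLift v (C.J v.proj (Z v.proj) : TangentSpace I v.proj) ∧
      C.ambientLiftedJ v (completeLift (fun y => (Z y : TangentSpace I y)) v) =
        completeLift (fun y => (C.J y (Z y) : TangentSpace I y)) v := by
  obtain ⟨Ω, P, hv, h⟩ := C.localEnd_spec v.proj
  have := h.toCoord_lift_J (v := v) (w := v) (mem_extChartAt_source v.proj) hv hU hvU hZ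
  simp only [extChartAt_tangent_self, toCoord_self] at this
  exact this

lemma ambientLiftedJ_mem {v : TangentBundle I M} (z : TangentSpace I.tangent v)
    (hz : z ∈ C.liftedLevi v) : C.ambientLiftedJ v z ∈ C.liftedLevi v := by
  have : C.liftedLevi v ≤ (C.liftedLevi v).comap (C.ambientLiftedJ v) := by
    refine Submodule.span_le.2 ?_
    rintro _ ⟨U, Z, hU, hv, hZ, rfl | rfl⟩
    · rw [SetLike.mem_coe, Submodule.mem_comap, (ambientLiftedJ_lift hU hv hZ).1]
      exact C.verticalLift_mem_liftedLevi hU hv (C.smooth_J U hU Z hZ)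
    · rw [SetLike.mem_coe, Submodule.mem_comap, (ambientLiftedJ_lift hU hv hZ).2]
      exact C.completeLift_mem_liftedLevi hU hv (C.smooth_J U hU Z hZ)
  exact this hz

/-- The endomorphism of the lifted distribution induced by the structure endomorphism. -/
def liftedJ (v : TangentBundle I M) : C.liftedLevi v →ₗ[ℝ] C.liftedLevi v :=
  (C.ambientLiftedJ v).restrict C.ambientLiftedJ_mem

variable {C} in
/-- The complete lift of a local representation represents the lifted structure. -/
lemma _root_.IsLocalRep.endLift {w : TangentBundle I M} {Ω : Set E} {P A : E → E →L[ℝ] E}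
    (h : IsLocalRep C.levi C.J w.proj Ω P A) :
    IsLocalRep C.liftedLevi C.liftedJ w (Prod.fst ⁻¹' Ω) (endLift P) (endLift A) where
  toIsComplexProjector := h.toIsComplexProjector.endLift
  subset_target q hq := by
    have hs := h.symm_mem_source hq
    have hq' : extChartAt I.tangent w ((extChartAt I.tangent w).symm q) = q := by
      rw [extChartAt_tangent_symm_apply, extChartAt_tangent_apply]
      exact Prod.ext (h.right_inv hq) (toCoord_ofCoord hs _)
    rw [← hq']
    exact (extChartAt I.tangent w).map_source (mem_extChartAt_tangent_source.2 hs)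
  mem_iff v hv hvΩ z := h.mem_liftedLevi_iff (mem_extChartAt_tangent_source.1 hv) hvΩ z
  -- `liftedJ` at `v` comes from the chart and local extension chosen at `v.proj`, whereas `A` lives
  -- in the chart at `w.proj`. Both send lifts of Z to lifts of JZ, so they agree on the span.
  toCoord_J v hv hvΩ z := C.eqOn_liftedLevi
    (S := (toCoord I.tangent w v).toLinearMap.comp (C.ambientLiftedJ v))
    (T := ((_root_.endLift A (extChartAt I.tangent w v)).comp
      (toCoord I.tangent w v)).toLinearMap)
    (fun U Z hU hvU hZ => by
      have h1 := ambientLiftedJ_lift hU hvU hZ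
      have h2 := h.toCoord_lift_J (mem_extChartAt_tangent_source.1 hv) hvΩ hU hvU hZ
      exact ⟨(congrArg (toCoord I.tangent w v) h1.1).trans h2.1.symm,
        (congrArg (toCoord I.tangent w v) h1.2).trans h2.2.symm⟩) z.2

lemma exists_localRep_lifted (v : TangentBundle I M) : ∃ Ω P A, extChartAt I.tangent v v ∈ Ω ∧
    IsLocalRep C.liftedLevi C.liftedJ v Ω P A := by
  obtain ⟨Ω, P, A, hx, h⟩ := C.exists_localRep v.proj
  exact ⟨_, _, _, hx, h.endLift⟩

/-- With D the derivative of P along the fibre vector, the lifted distribution consists of the (a,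
c) with Pa = a and Da + Pc = c. The shear (a, b) ↦ (a, b + Da) identifies it with two copies of the
fibre of HM. -/
lemma finrank_liftedLevi (v : TangentBundle I M) :
    Module.finrank ℝ (C.liftedLevi v) = 2 * Module.finrank ℝ (C.levi v.proj) := by
  obtain ⟨Ω, P, A, hx, h⟩ := C.exists_localRep v.proj
  set x := v.proj
  let N : Submodule ℝ E := C.levi x
  have hN : ∀ u : E, u ∈ N ↔ P (extChartAt I x x) u = u := h.mem_iff_self hx
  let D : E →L[ℝ] E := fderiv ℝ P (extChartAt I x x) v.snd
  have hD : ∀ u, D u = D (P (extChartAt I x x) u) + P (extChartAt I x x) (D u) := fun u =>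
    fderiv_comp_of_eqOn (h.differentiableAt_proj hx) (h.differentiableAt_proj hx)
      (eventually_of_mem (h.isOpen.mem_nhds hx) h.proj_proj) v.snd u
  -- Differentiating P² = P gives D = DP + PD; on a vector fixed by P this leaves PD = 0.
  have hPD : ∀ u ∈ N, P (extChartAt I x x) (D u) = 0 := fun u hu => by
    have := hD u
    rw [(hN u).1 hu] at this
    simpa using this
  let T : N × N →ₗ[ℝ] E × E :=
    (LinearMap.fst ℝ E E).prod ((LinearMap.snd ℝ E E) + D.toLinearMap.comp (LinearMap.fst ℝ E E))
      ∘ₗ (N.subtype.prodMap N.subtype)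
  have hT : ∀ n, T n = ((n.1 : E), (n.2 : E) + D n.1) := fun n => rfl
  have hTi : Function.Injective T := by
    rw [← LinearMap.ker_eq_bot, LinearMap.ker_eq_bot']
    rintro ⟨⟨a, ha⟩, ⟨b, hb⟩⟩ hn
    rw [hT, Prod.mk_eq_zero] at hn
    obtain ⟨rfl, h2⟩ := hn
    simp only [map_zero, add_zero] at h2
    subst h2
    rfl
  let L : Submodule ℝ (E × E) := C.liftedLevi v
  have hL : ∀ z : E × E, z ∈ L ↔
      P (extChartAt I x x) z.1 = z.1 ∧ D z.1 + P (extChartAt I x x) z.2 = z.2 := fun z =>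
    (h.mem_liftedLevi_iff_self hx z).trans Prod.ext_iff
  have hr : LinearMap.range T = L := by
    ext z
    rw [hL]
    constructor
    · rintro ⟨n, rfl⟩
      rw [hT, map_add, hPD _ n.1.2, (hN _).1 n.1.2, (hN _).1 n.2.2]
      exact ⟨rfl, by simp [add_comm]⟩
    · rintro ⟨h1, h2⟩
      refine ⟨(⟨z.1, (hN _).2 h1⟩, ⟨P (extChartAt I x x) z.2, (hN _).2 (h.proj_proj _ hx _)⟩), ?_⟩
      rw [hT]
      exact Prod.ext rfl ((add_comm _ _).trans h2)
  have : Module.finrank ℝ L = 2 * Module.finrank ℝ N := by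
    rw [← hr, LinearMap.finrank_range_of_inj hTi, Module.finrank_prod, two_mul]
  exact this

/-- The complete lift of an almost CR structure to the tangent bundle. -/
def lift : AlmostCRStructure I.tangent (TangentBundle I M) (2 * d) :=
  ofLocalRep C.liftedLevi C.liftedJ
    (fun v => by
      rw [C.finrank_liftedLevi, Module.finrank_prod, ← C.codim v.proj]
      ring)
    C.exists_localRep_lifted

variable {C} in
lemma isIntegrable_lift (hC : C.IsIntegrable) : C.lift.IsIntegrable := by
  have : CompleteSpace E := FiniteDimensional.complete ℝ E
  refine isIntegrable_of_localRep _ fun v => ?_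
  obtain ⟨Ω, P, A, hx, h⟩ := C.exists_localRep v.proj
  exact ⟨_, _, _, hx, h.endLift,
    h.isIntegrableProjector_endLift (isIntegrableProjector hC h)⟩

lemma isCompleteLift_lift : C.IsCompleteLift C.lift where
  levi_eq _ := rfl
  J_eq U hU A hA hAJ v hvU w := by
    have hc := hA.contMDiffAt hU hvU
    have hs := mem_extChartAt_source (I := I) v.proj
    have ht := mem_extChartAt_target (I := I) v.proj
    rw [completeLiftTensor_eq_endLift hc]
    refine C.eqOn_liftedLevi (S := C.ambientLiftedJ v)
      (T := (endLift (coordTensor A v.proj) (extChartAt I v.proj v.proj, v.snd)).toLinearMap)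
      (fun V Z hV hvV hZ => ?_) w.2
    -- The section is restricted to V ∩ U because `A` is smooth and extends J only over `U`.
    have hZ' : SmoothFieldOn I (fun y => (Z y : TangentSpace I y)) (V ∩ U) :=
      hZ.mono inter_subset_left
    have ev : ∀ᶠ p in 𝓝 (extChartAt I v.proj v.proj),
        coordTensor A v.proj p (coordField I v.proj (fun y => (Z y : TangentSpace I y)) p) =
          coordField I v.proj (fun y => (C.J y (Z y) : TangentSpace I y)) p := by
      filter_upwards [(isOpen_extChartAt_target v.proj).mem_nhds ht,
        (continuousAt_extChartAt_symm v.proj).preimage_mem_nhds (by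
          rw [extChartAt_to_inv]
          exact hU.mem_nhds hvU)] with p hp hpU
      rw [coordTensor_coordField A hp, coordField, coordField, hAJ _ hpU]
    have h1 := toCoord_lift (w := v) hs (hV.inter hU) ⟨hvV, hvU⟩ hZ'
      (((contMDiffAt_iff_contDiffAt_comp_extChartAt_symm hs).1 hc).differentiableAt (by simp))
      (C.smooth_J _ (hV.inter hU) Z hZ') ev
    have h2 := ambientLiftedJ_lift hV hvV hZ
    simp only [extChartAt_tangent_self, toCoord_self] at h1
    exact ⟨h2.1.trans h1.1.symm, h2.2.trans h1.2.symm⟩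
  J_lift U hU Z hZ v hv w :=
    ⟨fun hw => by
      refine Eq.trans ?_ (ambientLiftedJ_lift hU hv hZ).1
      rw [← hw]
      rfl, fun hw => by
      refine Eq.trans ?_ (ambientLiftedJ_lift hU hv hZ).2
      rw [← hw]
      rfl⟩

/-- In induced coordinates the projection is the first component, and the first components of the
lifts of P and A are P and A themselves. -/
lemma isCRMap_proj : IsCRMap C.lift C (fun v : TangentBundle I M => v.proj) := by
  refine ⟨Bundle.contMDiff_proj (TangentSpace I), fun v X => ?_⟩
  obtain ⟨Ω, P, hx, h⟩ := C.localEnd_spec v.proj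
  have e := mfderiv_tangentBundle_proj v (X : TangentSpace I.tangent v)
  have hX := (h.mem_liftedLevi_iff_self hx X).1 X.2
  have hm : mfderiv I.tangent I (fun v : TangentBundle I M => v.proj) v
      (X : TangentSpace I.tangent v) ∈ C.levi v.proj := by
    rw [e]
    exact (h.mem_iff_self hx _).2 (congrArg Prod.fst hX)
  refine ⟨hm, (mfderiv_tangentBundle_proj v _).trans ?_⟩
  refine Eq.trans ?_ (h.J_eq_self hx ⟨_, hm⟩).symm
  exact congrArg (C.localEnd v.proj (extChartAt I v.proj v.proj)) e.symm

end AlmostCRStructure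

end CompleteLift

end

theorem theorem5p5 {m d : ℕ} {M : Type*} [TopologicalSpace M]
    [ChartedSpace (EuclideanSpace ℝ (Fin m)) M] [IsManifold (𝓡 m) ∞ M]
    (C : AlmostCRStructure (𝓡 m) M d) (hC : C.IsIntegrable) :
    ∃ C' : AlmostCRStructure (𝓡 m).tangent (TangentBundle (𝓡 m) M) (2 * d),
      C'.IsIntegrable ∧
      IsCRMap C' C (fun v : TangentBundle (𝓡 m) M => v.proj) ∧
      C.IsCompleteLift C' :=
  ⟨C.lift, AlmostCRStructure.isIntegrable_lift hC, C.isCRMap_proj, C.isCompleteLift_lift⟩
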